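/- Let $p$ be a prime number, $F$ a finite extension of $\mathbb{Q}_p$ with its $p$-adic topology and ring of integers $\mathcal{O}_F$, and $E$ any field of characteristic $p$. Let $U=\begin{pmatrix}1&\mathcal{O}_F\\0&1\end{pmatrix}\subset \mathrm{GL}_2(F)$ and let $E[[U]]=\varprojlim_{U'}E[U/U']$, where $U'$ runs through the open subgroups of $U$, be its Iwasawa algebra over $E$. Let $\pi$ be an irreducible representation of $\mathrm{GL}_2(F)$ on an infinite-dimensional $E$-vector space which is smooth (the stabilizer of every vector is open). An element $a=(a_{U'})_{U'}\in E[[U]]$ acts on a vector $v\in\pi$ through $a_{U'}\in E[U/U']$, for any open subgroup $U'$ of $U$ fixing $v$. Then this action of $E[[U]]$ on $\pi$ is faithful, i.e. the homomorphism $E[[U]]\to\mathrm{End}_E(\pi)$ is injective. -/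

import Mathlib

namespace IwasawaGL2

/-- A representation of a topological group is smooth if the stabilizer of every vector is open. -/
def IsSmooth {E G W : Type*} [Field E] [Group G] [TopologicalSpace G] [AddCommGroup W] [Module E W]
    (ρ : Representation E G W) : Prop :=
  ∀ v : W, IsOpen {g : G | ρ g v = v}

/-- The restriction of a smooth representation to a subgroup, with its subspace topology, is
smooth. -/
theorem IsSmooth.restrict {E G W : Type*} [Field E] [Group G] [TopologicalSpace G]
    [AddCommGroup W] [Module E W] {ρ : Representation E G W} (hρ : IsSmooth ρ) (U : Subgroup G) :
    IsSmooth (E := E) (G := U) (W := W) (ρ.comp U.subtype) :=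
  fun v => (hρ v).preimage continuous_subtype_val

section IwasawaAlgebra

/-- For a commutative topological group `H` and open subgroups `V ≤ V'` of `H`, the transition map
`E[H/V] → E[H/V']` of group algebras. -/
noncomputable def transition (E : Type*) {H : Type*} [Field E] [CommGroup H] [TopologicalSpace H]
    {V V' : OpenSubgroup H} (h : V ≤ V') :
    MonoidAlgebra E (H ⧸ (V : Subgroup H)) →ₐ[E] MonoidAlgebra E (H ⧸ (V' : Subgroup H)) :=
  MonoidAlgebra.mapDomainAlgHom E E
    (QuotientGroup.map (V : Subgroup H) (V' : Subgroup H) (MonoidHom.id H) h)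

/-- The Iwasawa algebra (completed group algebra) `E[[H]] = lim E[H/V]` of a commutative topological
group `H`: the algebra of compatible families in the group algebras `E[H/V]`, where `V` runs
through the open subgroups of `H`. -/
noncomputable def IwasawaAlgebra (E H : Type*) [Field E] [CommGroup H] [TopologicalSpace H] :
    Subalgebra E (∀ V : OpenSubgroup H, MonoidAlgebra E (H ⧸ (V : Subgroup H))) where
  carrier := {a | ∀ (V V' : OpenSubgroup H) (h : V ≤ V'), transition E h (a V) = a V'}
  mul_mem' {a b} ha hb V V' h := by
    rw [Pi.mul_apply, Pi.mul_apply, map_mul, ha V V' h, hb V V' h]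
  add_mem' {a b} ha hb V V' h := by
    rw [Pi.add_apply, Pi.add_apply, map_add, ha V V' h, hb V V' h]
  algebraMap_mem' r V V' h := by
    rw [Pi.algebraMap_apply, Pi.algebraMap_apply, AlgHom.commutes]

variable {E H W : Type*} [Field E] [CommGroup H] [TopologicalSpace H] [AddCommGroup W] [Module E W]

/-- The stabilizer of a vector of a smooth representation, as an open subgroup. -/
def stab {ρ : Representation E H W} (hρ : IsSmooth ρ) (v : W) : OpenSubgroup H where
  carrier := {g | ρ g v = v}
  mul_mem' {g h} hg hh := by
    change ρ (g * h) v = v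
    rw [map_mul, Module.End.mul_apply, show ρ h v = v from hh, show ρ g v = v from hg]
  one_mem' := by
    change ρ 1 v = v
    rw [map_one, Module.End.one_apply]
  inv_mem' {g} hg := by
    change ρ g⁻¹ v = v
    conv_lhs => rw [← show ρ g v = v from hg]
    rw [Representation.inv_self_apply]
  isOpen' := hρ v

theorem mem_stab {ρ : Representation E H W} (hρ : IsSmooth ρ) (v : W) (g : H) :
    g ∈ stab hρ v ↔ ρ g v = v := Iff.rfl

/-- A vector fixed by `V`, as an element of the invariants `W^V`. -/
def toInv (ρ : Representation E H W) (V : OpenSubgroup H) (v : W) (hv : ∀ g ∈ V, ρ g v = v) :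
    Representation.invariants (MonoidHom.comp ρ (V : Subgroup H).subtype) :=
  ⟨v, fun g => hv g.1 g.2⟩

/-- The action of `x ∈ E[H/V]` on a vector `v` fixed by `V`, through the natural representation of
`H/V` on the invariants `W^V`. -/
noncomputable def finiteAct (ρ : Representation E H W) (V : OpenSubgroup H)
    (x : MonoidAlgebra E (H ⧸ (V : Subgroup H))) (v : W) (hv : ∀ g ∈ V, ρ g v = v) : W :=
  ((ρ.quotientToInvariants (V : Subgroup H)).asAlgebraHom x (toInv ρ V v hv)).1

theorem finiteAct_single (ρ : Representation E H W) (V : OpenSubgroup H) (g : H) (c : E) (v : W)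
    (hv : ∀ g ∈ V, ρ g v = v) :
    finiteAct ρ V (MonoidAlgebra.single (g : H ⧸ (V : Subgroup H)) c) v hv = c • ρ g v := by
  unfold finiteAct
  rw [Representation.asAlgebraHom_single]
  rfl

theorem finiteAct_fixed (ρ : Representation E H W) (V : OpenSubgroup H)
    (x : MonoidAlgebra E (H ⧸ (V : Subgroup H))) (v : W) (hv : ∀ g ∈ V, ρ g v = v) :
    ∀ g ∈ V, ρ g (finiteAct ρ V x v hv) = finiteAct ρ V x v hv :=
  fun g hg => ((ρ.quotientToInvariants (V : Subgroup H)).asAlgebraHom x (toInv ρ V v hv)).2 ⟨g, hg⟩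

theorem finiteAct_transition (ρ : Representation E H W) {V V' : OpenSubgroup H} (h : V ≤ V')
    (x : MonoidAlgebra E (H ⧸ (V : Subgroup H))) (v : W) (hv : ∀ g ∈ V', ρ g v = v) :
    finiteAct ρ V' (transition E h x) v hv = finiteAct ρ V x v (fun g hg => hv g (h hg)) := by
  induction x using MonoidAlgebra.induction_linear with
  | zero => simp [finiteAct]
  | add x y hx hy =>
    unfold finiteAct at hx hy ⊢
    simp only [map_add, LinearMap.add_apply, Submodule.coe_add, hx, hy]
  | single g c =>
    obtain ⟨g, rfl⟩ := QuotientGroup.mk_surjective g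
    rw [finiteAct_single]
    have : transition E h (MonoidAlgebra.single (g : H ⧸ (V : Subgroup H)) c) =
        MonoidAlgebra.single (g : H ⧸ (V' : Subgroup H)) c := by
      simp only [transition, MonoidAlgebra.mapDomainAlgHom_apply, MonoidAlgebra.mapDomain_single]
      rfl
    rw [this, finiteAct_single]

/-- The action of `a = (a_V)_V ∈ E[[H]]` on a vector `v` of a smooth representation: `v` is fixed by
the open subgroup `V = stab v`, and `a` acts on it through `a_V ∈ E[H/V]`. -/
noncomputable def act {ρ : Representation E H W} (hρ : IsSmooth ρ) (a : IwasawaAlgebra E H)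
    (v : W) : W :=
  finiteAct ρ (stab hρ v) (a.1 (stab hρ v)) v (fun g hg => (mem_stab hρ v g).1 hg)

/-- The action may be computed through `a_V` for any open subgroup `V` that fixes `v`. -/
theorem act_eq {ρ : Representation E H W} (hρ : IsSmooth ρ) (a : IwasawaAlgebra E H) (v : W)
    (V : OpenSubgroup H) (hv : ∀ g ∈ V, ρ g v = v) :
    act hρ a v = finiteAct ρ V (a.1 V) v hv := by
  have h : V ≤ stab hρ v := fun g hg => hv g hg
  unfold act
  rw [← finiteAct_transition ρ h (a.1 V) v (fun g hg => (mem_stab hρ v g).1 hg), a.2 V (stab hρ v) h]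

/-- The natural action of the Iwasawa algebra `E[[H]]` on a smooth `E`-representation of `H`, as a
homomorphism of `E`-algebras `E[[H]] → End_E(W)`. -/
noncomputable def iwasawaAction {ρ : Representation E H W} (hρ : IsSmooth ρ) :
    IwasawaAlgebra E H →ₐ[E] Module.End E W where
  toFun a :=
    { toFun := act hρ a
      map_add' := fun v w => by
        have hv : ∀ g ∈ stab hρ v ⊓ stab hρ w, ρ g v = v := fun g hg => hg.1
        have hw : ∀ g ∈ stab hρ v ⊓ stab hρ w, ρ g w = w := fun g hg => hg.2
        have hvw : ∀ g ∈ stab hρ v ⊓ stab hρ w, ρ g (v + w) = v + w := fun g hg => by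
          rw [map_add, hv g hg, hw g hg]
        rw [act_eq hρ a v _ hv, act_eq hρ a w _ hw, act_eq hρ a (v + w) _ hvw]
        unfold finiteAct
        rw [← Submodule.coe_add, ← map_add]
        rfl
      map_smul' := fun c v => by
        have hv : ∀ g ∈ stab hρ v, ρ g v = v := fun g hg => hg
        have hcv : ∀ g ∈ stab hρ v, ρ g (c • v) = c • v := fun g hg => by
          rw [map_smul, hv g hg]
        rw [act_eq hρ a v _ hv, act_eq hρ a (c • v) _ hcv, RingHom.id_apply]
        unfold finiteAct
        rw [← Submodule.coe_smul, ← map_smul]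
        rfl }
  map_one' := by
    ext v
    change ((ρ.quotientToInvariants (stab hρ v : Subgroup H)).asAlgebraHom 1
      (toInv ρ (stab hρ v) v fun g hg => (mem_stab hρ v g).1 hg)).1 = v
    rw [map_one]
    rfl
  map_mul' a b := by
    ext v
    change act hρ (a * b) v = act hρ a (act hρ b v)
    have hv : ∀ g ∈ stab hρ v, ρ g v = v := fun g hg => hg
    rw [act_eq hρ b v _ hv, act_eq hρ a _ _ (finiteAct_fixed ρ _ _ v hv),
      act_eq hρ (a * b) v _ hv]
    unfold finiteAct
    change ((ρ.quotientToInvariants _).asAlgebraHom (a.1 (stab hρ v) * b.1 (stab hρ v)) _).1 = _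
    rw [map_mul]
    rfl
  map_zero' := by
    ext v
    change ((ρ.quotientToInvariants (stab hρ v : Subgroup H)).asAlgebraHom 0
      (toInv ρ (stab hρ v) v fun g hg => (mem_stab hρ v g).1 hg)).1 = 0
    rw [map_zero]
    rfl
  map_add' a b := by
    ext v
    change ((ρ.quotientToInvariants (stab hρ v : Subgroup H)).asAlgebraHom
      (a.1 (stab hρ v) + b.1 (stab hρ v)) (toInv ρ (stab hρ v) v fun g hg => (mem_stab hρ v g).1 hg)).1 =
        act hρ a v + act hρ b v
    rw [map_add]
    rfl
  commutes' c := by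
    ext v
    change ((ρ.quotientToInvariants (stab hρ v : Subgroup H)).asAlgebraHom
      (algebraMap E (MonoidAlgebra E (H ⧸ (stab hρ v : Subgroup H))) c)
      (toInv ρ (stab hρ v) v fun g hg => (mem_stab hρ v g).1 hg)).1 = _
    rw [AlgHom.commutes]
    rfl

end IwasawaAlgebra

section GL2

variable (p : ℕ) [Fact p.Prime] (F : Type*) [NormedField F] [NormedAlgebra ℚ_[p] F]

/-- The ring of integers of an extension `F` of `ℚ_p`: the integral closure of `ℤ_p` in `F`. -/
noncomputable def ringOfIntegers : Subring F := (integralClosure (PadicInt.subring p) F).toSubring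

/-- The subgroup `U` of `GL₂(F)` of the matrices `(1 x; 0 1)` with `x` in the ring of integers. -/
noncomputable def unipotent : Subgroup (GL (Fin 2) F) where
  carrier := {g | ∃ x ∈ ringOfIntegers p F, (g : Matrix (Fin 2) (Fin 2) F) = !![1, x; 0, 1]}
  mul_mem' := by
    rintro g h ⟨x, hx, hg⟩ ⟨y, hy, hh⟩
    refine ⟨y + x, add_mem hy hx, ?_⟩
    rw [Units.val_mul, hg, hh]
    simp
  one_mem' := ⟨0, zero_mem _, by rw [Units.val_one, Matrix.one_fin_two]⟩
  inv_mem' := by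
    rintro g ⟨x, hx, hg⟩
    refine ⟨-x, neg_mem hx, ?_⟩
    rw [Matrix.coe_units_inv, hg]
    simp [Matrix.inv_def, Matrix.det_fin_two, Matrix.adjugate_fin_two]

noncomputable instance : CommGroup (unipotent p F) where
  mul_comm := by
    rintro ⟨g, x, hx, hg⟩ ⟨h, y, hy, hh⟩
    apply Subtype.ext
    apply Units.ext
    change (g : Matrix (Fin 2) (Fin 2) F) * h = (h : Matrix (Fin 2) (Fin 2) F) * g
    rw [hg, hh]
    simp [add_comm]

end GL2

end IwasawaGL2

/-! Suppose that a nonzero `x` in `E[[U]]` kills `π`, and let `I` be the annihilator of `π`.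
Conjugation by `diag(a, 1)` scales `U` by `a`, so `I` contains the image of `x` under scaling by
every nonzero integer `a`. Scaling by `0` sends `x` to its augmentation, which vanishes because a
large power of `p` scales `U` into the stabilizer of a given vector. The central result,
`exists_pow_mem_of_map_mem`, deduces that a power of each `[e] - 1`, for `e` among the
representatives of `U / U ^ p`, lies in `I`. In characteristic `p` this makes some nontrivial `e ^ p
^ n` act trivially. The kernel of `π` then contains `SL₂(F)`, so `π` factors through the
determinant, and Zariski's lemma makes it finite-dimensional, a contradiction.

The central result is a density argument for nonarchimedean integrals. If it fails,
`exists_valuation` gives a homomorphism `f` from `E[[U]]` to a field `K` that kills `I`, with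
integral values for an archimedean (rank one) valuation, such that `χ(h) = f([h])` is a nontrivial
character. Regard `x` as a measure on `U`: the integral of `χ ∘ θ` is the value of `f` at the twist
of `x` by `θ`, hence zero for all scalings `θ`. These functions are closed under products, so their
span is an algebra. Kaplansky's polynomial lemma (`exists_polynomial_separating`) yields a function
in it that is close to the characteristic function of a coset on which `x` has nonzero mass. Nonzero
elements of `E` have valuation one, so this integral cannot vanish.

Continuity of `f` is not assumed. Integrals are replaced by finite Riemann sums, and their errors
are controlled algebraically through the finite generation of the kernels of `E[[H]] → E[H / H ^ p ^
n]` (`mem_span_of_proj_eq_zero`). -/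

namespace IwasawaGL2

/-! ### Iwasawa algebras of groups filtered by powers, and generators of the kernels to finite
level. -/

/-- The data expressing that the subgroups of `p ^ n`-th powers of `H` are open and form a
neighbourhood basis of the identity, together with finitely many representatives of `H / H ^ p`. -/
structure PowerFiltration (p : ℕ) (H : Type*) [CommGroup H] [TopologicalSpace H] where
  level : ℕ → OpenSubgroup H
  mem_level : ∀ n h, h ∈ level n ↔ ∃ t, t ^ p ^ n = h
  exists_level_le : ∀ V : OpenSubgroup H, ∃ n, level n ≤ V
  reps : Finset H
  exists_rep : ∀ t, ∃ e ∈ reps, ∃ s, t = e * s ^ p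

namespace IwasawaAlgebra

variable {E H : Type*} [Field E] [CommGroup H] [TopologicalSpace H]

/-- The projection `E[[H]] → E[H/V]`. -/
noncomputable def proj (V : OpenSubgroup H) :
    IwasawaAlgebra E H →ₐ[E] MonoidAlgebra E (H ⧸ (V : Subgroup H)) :=
  (Pi.evalAlgHom E _ V).comp (IwasawaAlgebra E H).val

theorem transition_proj {V V' : OpenSubgroup H} (h : V ≤ V') (a : IwasawaAlgebra E H) :
    transition E h (proj V a) = proj V' a := a.2 V V' h

theorem transition_single {V V' : OpenSubgroup H} (h : V ≤ V') (g : H) (c : E) :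
    transition E h (MonoidAlgebra.single (g : H ⧸ (V : Subgroup H)) c) =
      MonoidAlgebra.single (g : H ⧸ (V' : Subgroup H)) c := by
  simp only [transition, MonoidAlgebra.mapDomainAlgHom_apply, MonoidAlgebra.mapDomain_single]
  rfl

theorem proj_eq_zero_of_le {V V' : OpenSubgroup H} (h : V ≤ V') {a : IwasawaAlgebra E H}
    (ha : proj V a = 0) : proj V' a = 0 := by
  rw [← transition_proj h, ha, map_zero]

theorem ext_proj {a b : IwasawaAlgebra E H} (h : ∀ V, proj V a = proj V b) : a = b :=
  Subtype.ext (funext h)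

/-- The group element `g ∈ H` as an element of `E[[H]]`. -/
noncomputable def of : H →* IwasawaAlgebra E H where
  toFun g := ⟨fun V => MonoidAlgebra.single (g : H ⧸ (V : Subgroup H)) 1,
    fun _ _ h => transition_single h g 1⟩
  map_one' := rfl
  map_mul' g h := by
    refine Subtype.ext (funext fun V => ?_)
    change _ = MonoidAlgebra.single (g : H ⧸ (V : Subgroup H)) (1 : E) *
      MonoidAlgebra.single (h : H ⧸ (V : Subgroup H)) (1 : E)
    rw [MonoidAlgebra.single_mul_single, one_mul]
    rfl

theorem proj_of (V : OpenSubgroup H) (g : H) :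
    proj V (of g : IwasawaAlgebra E H) = MonoidAlgebra.single (g : H ⧸ (V : Subgroup H)) 1 := rfl

theorem proj_surjective (V : OpenSubgroup H) :
    Function.Surjective (proj V : IwasawaAlgebra E H →ₐ[E] _) := by
  intro x
  induction x using MonoidAlgebra.induction_linear with
  | zero => exact ⟨0, map_zero _⟩
  | add x y hx hy =>
    obtain ⟨a, rfl⟩ := hx
    obtain ⟨b, rfl⟩ := hy
    exact ⟨a + b, map_add _ _ _⟩
  | single g c =>
    obtain ⟨g, rfl⟩ := QuotientGroup.mk_surjective g
    refine ⟨c • of g, ?_⟩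
    rw [map_smul, proj_of, MonoidAlgebra.smul_single, smul_eq_mul, mul_one]

instance : Nontrivial (IwasawaAlgebra E H) :=
  (proj (E := E) (⊤ : OpenSubgroup H)).toRingHom.domain_nontrivial

instance (p : ℕ) [CharP E p] : CharP (IwasawaAlgebra E H) p :=
  charP_of_injective_algebraMap (algebraMap E (IwasawaAlgebra E H)).injective p

theorem of_sub_one_pow (p : ℕ) [Fact p.Prime] [CharP E p] (g : H) (n : ℕ) :
    (of g - 1 : IwasawaAlgebra E H) ^ p ^ n = of (g ^ p ^ n) - 1 := by
  rw [sub_pow_char_pow, one_pow, map_pow]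

/-- A sequence in `E[[H]]` that is eventually constant in each `E[H/V]` converges. -/
theorem exists_limit (u : ℕ → IwasawaAlgebra E H)
    (hu : ∀ V : OpenSubgroup H, ∃ K, ∀ k ≥ K, proj V (u k) = proj V (u K)) :
    ∃ l : IwasawaAlgebra E H, ∀ V : OpenSubgroup H, ∃ K, ∀ k ≥ K, proj V (u k) = proj V l := by
  choose K hK using hu
  refine ⟨⟨fun V => proj V (u (K V)), fun V V' h => ?_⟩, fun V => ⟨K V, hK V⟩⟩
  change transition E h (proj V (u (K V))) = proj V' (u (K V'))
  rw [← hK V _ (le_max_left _ (K V')), ← hK V' _ (le_max_right (K V) _), transition_proj]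

/-- The kernel of a transition map between group algebras is generated by group elements. -/
theorem ker_transition_le {V V' : OpenSubgroup H} (h : V ≤ V')
    (J : Ideal (MonoidAlgebra E (H ⧸ (V : Subgroup H))))
    (hJ : ∀ g ∈ V', MonoidAlgebra.single (g : H ⧸ (V : Subgroup H)) (1 : E) - 1 ∈ J)
    (x : MonoidAlgebra E (H ⧸ (V : Subgroup H))) (hx : transition E h x = 0) : x ∈ J := by
  -- Modulo `J` the elements of `V'` become `1`, so the quotient map by `J` factors through the
  -- transition map and kills its kernel.
  let f : H →* (MonoidAlgebra E (H ⧸ (V : Subgroup H)) ⧸ J) :=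
    (Ideal.Quotient.mk J).toMonoidHom.comp ((MonoidAlgebra.of E _).comp (QuotientGroup.mk' (V : Subgroup H)))
  have hf : ∀ g ∈ (V' : Subgroup H), f g = 1 := fun g hg => by
    change Ideal.Quotient.mk J (MonoidAlgebra.single _ 1) = 1
    rw [← map_one (Ideal.Quotient.mk J), Ideal.Quotient.eq]
    exact hJ g hg
  let F : MonoidAlgebra E (H ⧸ (V' : Subgroup H)) →ₐ[E] _ :=
    MonoidAlgebra.lift E (MonoidAlgebra E (H ⧸ (V : Subgroup H)) ⧸ J) _ (QuotientGroup.lift (V' : Subgroup H) f hf)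
  have hF : F.comp (transition E h) = Ideal.Quotient.mkₐ E J := by
    refine MonoidAlgebra.algHom_ext (fun g => ?_) (Subsingleton.elim _ _)
    obtain ⟨g, rfl⟩ := QuotientGroup.mk_surjective g
    rw [AlgHom.comp_apply, transition_single]
    simp only [F, MonoidAlgebra.lift_single, one_smul]
    rfl
  have := congrArg (fun φ => φ x) hF
  simp only [AlgHom.comp_apply, hx, map_zero] at this
  exact Ideal.Quotient.eq_zero_iff_mem.1 this.symm

end IwasawaAlgebra

namespace PowerFiltration
open IwasawaAlgebra

variable {E H : Type*} [Field E] [CommGroup H] [TopologicalSpace H]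
  {p : ℕ} (L : PowerFiltration p H)

theorem pow_mem_level (n : ℕ) (h : H) : h ^ p ^ n ∈ L.level n := (L.mem_level n _).2 ⟨h, rfl⟩

theorem level_anti {m n : ℕ} (h : m ≤ n) : L.level n ≤ L.level m := by
  intro g hg
  obtain ⟨t, rfl⟩ := (L.mem_level n g).1 hg
  obtain ⟨k, rfl⟩ := Nat.exists_eq_add_of_le h
  rw [pow_add, mul_comm, pow_mul]
  exact L.pow_mem_level m _

theorem ext_level {a b : IwasawaAlgebra E H} (h : ∀ n, proj (L.level n) a = proj (L.level n) b) :
    a = b :=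
  ext_proj fun V => by
    obtain ⟨n, hn⟩ := L.exists_level_le V
    rw [← transition_proj hn, h, transition_proj]

/-- One step of successive approximation. Writing `t = e * s ^ p` gives `t ^ p ^ n ≡ e ^ p ^ n`
modulo `p ^ (n + 1)`-th powers, so finitely many generators suffice at the next level. -/
theorem exists_approx (n : ℕ) (z : IwasawaAlgebra E H) (hz : proj (L.level n) z = 0) :
    ∃ b : H → IwasawaAlgebra E H,
      proj (L.level (n + 1)) (z - ∑ e ∈ L.reps, b e * (of (e ^ p ^ n) - 1)) = 0 := by
  set π := proj (E := E) (L.level (n + 1))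
  have key := ker_transition_le (L.level_anti (Nat.le_succ n))
    (Ideal.span ((fun e : H => π (of (e ^ p ^ n) - 1)) '' L.reps)) ?_ (π z)
    (by rw [transition_proj, hz])
  · obtain ⟨c, hc⟩ := (Submodule.mem_span_image_finset_iff_exists_fun _).1 key
    choose b hb using fun e => proj_surjective (E := E) (L.level (n + 1)) (c e)
    classical
    refine ⟨fun e => if h : e ∈ L.reps then b ⟨e, h⟩ else 0, ?_⟩
    rw [map_sub, map_sum, ← hc, sub_eq_zero, ← Finset.sum_coe_sort L.reps]
    refine Finset.sum_congr rfl fun e _ => ?_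
    simp only [map_mul, e.2, dif_pos, smul_eq_mul, ← hb]
    rfl
  · intro g hg
    obtain ⟨t, rfl⟩ := (L.mem_level n g).1 hg
    obtain ⟨e, he, s, rfl⟩ := L.exists_rep t
    refine Ideal.subset_span ⟨e, he, ?_⟩
    change π (of (e ^ p ^ n) - 1) = _
    rw [map_sub, map_one, proj_of]
    congr 2
    rw [QuotientGroup.eq, mul_pow, ← pow_mul, ← pow_succ', inv_mul_cancel_left]
    exact L.pow_mem_level _ s

variable [Fact p.Prime] [CharP E p]

theorem proj_of_sub_one_pow (m : ℕ) (g : H) {k : ℕ} (hk : p ^ m ≤ k) :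
    proj (L.level m) ((of g - 1 : IwasawaAlgebra E H) ^ k) = 0 := by
  obtain ⟨j, rfl⟩ := Nat.exists_eq_add_of_le hk
  rw [pow_add, of_sub_one_pow, map_mul, map_sub, proj_of, map_one,
    (QuotientGroup.eq_one_iff _).2 (L.pow_mem_level m g)]
  exact mul_eq_zero_of_left (sub_self _) _

/-- The kernel of `E[[H]] → E[H/H ^ p ^ n]` is generated by the elements `e ^ p ^ n - 1`, for `e`
in a set of representatives of `H / H ^ p`. -/
theorem mem_span_of_proj_eq_zero (n : ℕ) (z : IwasawaAlgebra E H)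
    (hz : proj (L.level n) z = 0) :
    z ∈ Ideal.span ((fun e : H => (of (e ^ p ^ n) - 1 : IwasawaAlgebra E H)) '' L.reps) := by
  choose! b hb using fun k => L.exists_approx (E := E) (n + k)
  let r : ℕ → IwasawaAlgebra E H := fun k => Nat.rec z
    (fun k z => z - ∑ e ∈ L.reps, b k z e * (of (e ^ p ^ (n + k)) - 1)) k
  have hr : ∀ k, proj (L.level (n + k)) (r k) = 0 := fun k => by
    induction k with
    | zero => exact hz
    | succ k ih => exact hb k _ ih
  let w : H → IwasawaAlgebra E H := fun e => of (e ^ p ^ n) - 1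
  -- By Frobenius every later correction is a multiple of the same `w e`, so the infinite sum of
  -- corrections can be collected into one coefficient per representative.
  have hw : ∀ e k, (of (e ^ p ^ (n + k)) - 1 : IwasawaAlgebra E H) = w e ^ (p ^ k - 1) * w e := by
    intro e k
    rw [← pow_succ, Nat.sub_add_cancel (Nat.one_le_pow _ _ (Nat.Prime.pos Fact.out)),
      of_sub_one_pow, ← pow_mul, pow_add]
  let β : H → ℕ → IwasawaAlgebra E H := fun e K =>
    ∑ k ∈ Finset.range K, b k (r k) e * w e ^ (p ^ k - 1)
  have hrK : ∀ K, z = r K + ∑ e ∈ L.reps, β e K * w e := fun K => by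
    induction K with
    | zero => simp [β, r]
    | succ K ih =>
      have : r (K + 1) = r K - ∑ e ∈ L.reps, b K (r K) e * (w e ^ (p ^ K - 1) * w e) := by
        simp only [← hw]; rfl
      rw [this]
      conv_lhs => rw [ih]
      simp only [β, Finset.sum_range_succ, add_mul, Finset.sum_add_distrib, mul_assoc]
      abel
  have hβ : ∀ e, ∃ l : IwasawaAlgebra E H, ∀ V : OpenSubgroup H, ∃ K, ∀ k ≥ K,
      proj V (β e k) = proj V l := by
    refine fun e => exists_limit _ fun V => ?_
    obtain ⟨m, hm⟩ := L.exists_level_le V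
    -- The exponent `p ^ k - 1` is at least `p ^ m` only once `k > m`, hence the shift by one.
    refine ⟨m + 1, fun k hk => ?_⟩
    induction k, hk using Nat.le_induction with
    | base => rfl
    | succ k hk ih =>
      rw [← ih]
      simp only [β, Finset.sum_range_succ, map_add]
      rw [add_eq_left, map_mul]
      refine mul_eq_zero_of_right _ (proj_eq_zero_of_le hm (L.proj_of_sub_one_pow m _ ?_))
      have h1 : p ^ m < p ^ k := Nat.pow_lt_pow_right (Nat.Prime.one_lt Fact.out) hk
      omega
  choose l hl using hβ
  have : z = ∑ e ∈ L.reps, l e * w e := by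
    refine L.ext_level fun m => ?_
    choose K hK using fun e => hl e (L.level m)
    let M := max (L.reps.sup K) m
    conv_lhs => rw [hrK M]
    rw [map_add, proj_eq_zero_of_le (L.level_anti ((le_max_right _ _).trans (Nat.le_add_left _ _)))
      (hr M), zero_add, map_sum, map_sum]
    refine Finset.sum_congr rfl fun e he => ?_
    rw [map_mul, map_mul, hK e M ((Finset.le_sup he).trans (le_max_left _ _))]
  rw [this]
  exact Ideal.sum_mem _ fun e he => Ideal.mul_mem_left _ _ (Ideal.subset_span ⟨e, he, rfl⟩)

end PowerFiltration
end IwasawaGL2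
-- Augmentation, locality and functoriality of the Iwasawa algebra.
namespace IwasawaGL2
namespace IwasawaAlgebra

variable {E H : Type*} [Field E] [CommGroup H] [TopologicalSpace H]

/-- The sum of the coefficients, as a homomorphism from a group algebra. -/
noncomputable def coeffSum (E : Type*) [Field E] (G : Type*) [Monoid G] : MonoidAlgebra E G →ₐ[E] E :=
  MonoidAlgebra.lift E E G 1

theorem coeffSum_single {G : Type*} [Monoid G] (g : G) (c : E) :
    coeffSum E G (MonoidAlgebra.single g c) = c := by
  simp [coeffSum]

theorem coeffSum_transition {V V' : OpenSubgroup H} (h : V ≤ V')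
    (x : MonoidAlgebra E (H ⧸ (V : Subgroup H))) :
    coeffSum E _ (transition E h x) = coeffSum E _ x := by
  induction x using MonoidAlgebra.induction_linear with
  | zero => simp only [map_zero]
  | add x y hx hy => rw [map_add, map_add, map_add, hx, hy]
  | single g c =>
    obtain ⟨g, rfl⟩ := QuotientGroup.mk_surjective g
    rw [transition_single, coeffSum_single, coeffSum_single]

/-- The augmentation `E[[H]] → E`. -/
noncomputable def aug : IwasawaAlgebra E H →ₐ[E] E := (coeffSum E _).comp (proj ⊤)

theorem coeffSum_proj (V : OpenSubgroup H) (a : IwasawaAlgebra E H) :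
    coeffSum E _ (proj V a) = aug a := by
  rw [← coeffSum_transition (le_top : V ≤ ⊤), transition_proj]
  rfl

theorem aug_of (g : H) : aug (of g : IwasawaAlgebra E H) = 1 := by
  change coeffSum E _ (proj ⊤ (of g)) = 1
  rw [proj_of, coeffSum_single]

/-- Frobenius is additive and kills the group part, so only the scalar part survives. -/
theorem single_pow_eq (p : ℕ) [Fact p.Prime] [CharP E p] {G : Type*} [CommGroup G] (k : ℕ)
    (hG : ∀ g : G, g ^ p ^ k = 1) (x : MonoidAlgebra E G) :
    x ^ p ^ k = algebraMap E _ (coeffSum E G x ^ p ^ k) := by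
  have : CharP (MonoidAlgebra E G) p :=
    charP_of_injective_algebraMap (algebraMap E (MonoidAlgebra E G)).injective p
  induction x using MonoidAlgebra.induction_linear with
  | zero => simp [zero_pow (pow_ne_zero k (Nat.Prime.ne_zero (Fact.out : p.Prime)))]
  | add x y hx hy => rw [add_pow_char_pow, hx, hy, map_add, add_pow_char_pow, map_add]
  | single g c =>
    rw [coeffSum_single, MonoidAlgebra.single_pow, hG]
    rfl

end IwasawaAlgebra

namespace PowerFiltration
open IwasawaAlgebra

variable {E H : Type*} [Field E] [CommGroup H] [TopologicalSpace H]
  {p : ℕ} (L : PowerFiltration p H) [Fact p.Prime] [CharP E p]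
include L

/-- At each finite level a power of `a` is a nonzero scalar. The inverses at the various levels are
compatible because inverses are unique. -/
theorem isUnit_of_aug_ne_zero (a : IwasawaAlgebra E H) (ha : aug a ≠ 0) : IsUnit a := by
  have hu : ∀ V : OpenSubgroup H, IsUnit (proj V a) := fun V => by
    obtain ⟨k, hk⟩ := L.exists_level_le V
    have : proj V a ^ p ^ k = algebraMap E _ (aug a ^ p ^ k) := by
      rw [← coeffSum_proj V]
      refine single_pow_eq p k (fun g => ?_) _
      obtain ⟨g, rfl⟩ := QuotientGroup.mk_surjective g
      exact (QuotientGroup.eq_one_iff _).2 (hk (L.pow_mem_level k g))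
    refine (isUnit_pow_iff (pow_ne_zero k (Nat.Prime.ne_zero (Fact.out : p.Prime)))).1 ?_
    rw [this]
    exact (IsUnit.mk0 _ (pow_ne_zero _ ha)).map _
  choose b hb using fun V => (hu V).exists_right_inv
  refine IsUnit.of_mul_eq_one ⟨b, fun V V' h => ?_⟩ (Subtype.ext (funext hb))
  have h1 : proj V' a * transition E h (b V) = 1 := by
    rw [← transition_proj h, ← map_mul, hb, map_one]
  exact (hu V').mul_left_cancel (h1.trans (hb V').symm)

theorem isLocalRing (E : Type*) [Field E] [CharP E p] : IsLocalRing (IwasawaAlgebra E H) := by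
  refine IsLocalRing.of_nonunits_add fun a b ha hb hab => ?_
  have h0 : ∀ c : IwasawaAlgebra E H, c ∈ nonunits _ → aug c = 0 := fun c hc =>
    not_not.1 fun h => hc (L.isUnit_of_aug_ne_zero c h)
  have := hab.map (aug : IwasawaAlgebra E H →ₐ[E] E)
  rw [map_add, h0 a ha, h0 b hb, add_zero] at this
  exact not_isUnit_zero this

end PowerFiltration

namespace IwasawaAlgebra

variable {E H : Type*} [Field E] [CommGroup H] [TopologicalSpace H]

theorem le_comap (θ : H →* H) (hθ : Continuous θ) (V : OpenSubgroup H) :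
    (V.comap θ hθ : Subgroup H) ≤ (V : Subgroup H).comap θ := fun _ h => h

/-- The homomorphism `E[H/θ⁻¹(V)] → E[H/V]` induced by a continuous endomorphism `θ` of `H`. -/
noncomputable def mapLevel (E : Type*) [Field E] (θ : H →* H) (hθ : Continuous θ)
    (V : OpenSubgroup H) :
    MonoidAlgebra E (H ⧸ (V.comap θ hθ : Subgroup H)) →ₐ[E] MonoidAlgebra E (H ⧸ (V : Subgroup H)) :=
  MonoidAlgebra.mapDomainAlgHom E E (QuotientGroup.map _ _ θ (le_comap θ hθ V))

theorem mapLevel_single (θ : H →* H) (hθ : Continuous θ) (V : OpenSubgroup H) (g : H) (c : E) :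
    mapLevel E θ hθ V (MonoidAlgebra.single (g : H ⧸ (V.comap θ hθ : Subgroup H)) c) =
      MonoidAlgebra.single (θ g : H ⧸ (V : Subgroup H)) c := by
  simp only [mapLevel, MonoidAlgebra.mapDomainAlgHom_apply, MonoidAlgebra.mapDomain_single]
  rfl

/-- The endomorphism of `E[[H]]` induced by a continuous endomorphism of `H`. -/
noncomputable def map (θ : H →* H) (hθ : Continuous θ) :
    IwasawaAlgebra E H →ₐ[E] IwasawaAlgebra E H :=
  (AlgHom.pi fun V : OpenSubgroup H => (mapLevel E θ hθ V).comp (proj (V.comap θ hθ))).codRestrict _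
    (by
      intro a V V' h
      have h' : V.comap θ hθ ≤ V'.comap θ hθ := fun g hg => h hg
      change transition E h (mapLevel E θ hθ V (proj (V.comap θ hθ) a)) =
        mapLevel E θ hθ V' (proj (V'.comap θ hθ) a)
      rw [← transition_proj h' a]
      generalize proj (V.comap θ hθ) a = x
      induction x using MonoidAlgebra.induction_linear with
      | zero => simp only [map_zero]
      | add x y hx hy => simp only [map_add, hx, hy]
      | single g c =>
        obtain ⟨g, rfl⟩ := QuotientGroup.mk_surjective g
        rw [transition_single, mapLevel_single, mapLevel_single, transition_single])

theorem proj_map (θ : H →* H) (hθ : Continuous θ) (V : OpenSubgroup H) (a : IwasawaAlgebra E H) :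
    proj V (map θ hθ a) = mapLevel E θ hθ V (proj (V.comap θ hθ) a) := rfl

theorem map_of (θ : H →* H) (hθ : Continuous θ) (g : H) :
    map θ hθ (of g : IwasawaAlgebra E H) = of (θ g) := by
  refine ext_proj fun V => ?_
  rw [proj_map, proj_of, proj_of, mapLevel_single]

end IwasawaAlgebra
end IwasawaGL2
-- Construction of an archimedean valuation.
namespace IwasawaGL2

/-- An ideal that is maximal among those not containing a common power of all elements of `Y` is
prime. -/
theorem isPrime_of_maximal_pow_notMem {A : Type*} [CommRing A] (Y : Finset A) (Q : Ideal A)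
    (hQ : Maximal (fun J : Ideal A => ¬ ∃ n : ℕ, ∀ y ∈ Y, y ^ n ∈ J) Q) : Q.IsPrime := by
  have key : ∀ a ∉ Q, ∃ n : ℕ, ∀ y ∈ Y, y ^ n ∈ Q ⊔ Ideal.span {a} := fun a ha => by
    by_contra h
    exact ha (hQ.2 h le_sup_left (Ideal.mem_sup_right (Ideal.mem_span_singleton_self a)))
  refine ⟨fun h => hQ.1 ⟨0, fun y _ => h ▸ Submodule.mem_top⟩, fun {a b} hab => ?_⟩
  by_contra! h
  obtain ⟨n, hn⟩ := key a h.1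
  obtain ⟨m, hm⟩ := key b h.2
  refine hQ.1 ⟨n + m, fun y hy => ?_⟩
  have h1 := Ideal.mul_mem_mul (hn y hy) (hm y hy)
  rw [← pow_add] at h1
  refine (Ideal.mul_le.2 fun r hr s hs => ?_ : _ ≤ Q) h1
  obtain ⟨q, hq, x, hx, rfl⟩ := Submodule.mem_sup.1 hr
  obtain ⟨q', hq', x', hx', rfl⟩ := Submodule.mem_sup.1 hs
  obtain ⟨c, rfl⟩ := Ideal.mem_span_singleton.1 hx
  obtain ⟨d, rfl⟩ := Ideal.mem_span_singleton.1 hx'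
  have : (q + a * c) * (q' + b * d) = q * (q' + b * d) + (a * c) * q' + (a * b) * (c * d) := by ring
  rw [this]
  exact add_mem (add_mem (Q.mul_mem_right _ hq) (Q.mul_mem_left _ hq')) (Q.mul_mem_right _ hab)

/-- Zorn's lemma applies because `Y` is finite: if the union of a chain contains the `n`-th powers
of all elements of `Y`, then so does a single member. -/
theorem exists_maximal_pow_notMem {A : Type*} [CommRing A] (Y : Finset A) (I : Ideal A)
    (hI : ¬ ∃ n : ℕ, ∀ y ∈ Y, y ^ n ∈ I) :
    ∃ Q, I ≤ Q ∧ Maximal (fun J : Ideal A => ¬ ∃ n : ℕ, ∀ y ∈ Y, y ^ n ∈ J) Q := by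
  refine zorn_le_nonempty₀ {J : Ideal A | ¬ ∃ n : ℕ, ∀ y ∈ Y, y ^ n ∈ J} (fun c hc hchain J₀ hJ₀ =>
    ⟨sSup c, ?_, fun J hJ => le_sSup hJ⟩) I hI
  rintro ⟨n, hn⟩
  suffices h : ∃ J ∈ c, ∀ y ∈ Y, y ^ n ∈ J by
    obtain ⟨J, hJ, h⟩ := h
    exact hc hJ ⟨n, h⟩
  clear hI hc
  induction Y using Finset.cons_induction with
  | empty => exact ⟨J₀, hJ₀, by simp⟩
  | cons a Y ha ih =>
    obtain ⟨J, hJ, h⟩ := ih fun y hy => hn y (Finset.mem_cons_of_mem hy)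
    obtain ⟨J', hJ', h'⟩ := (Submodule.mem_sSup_of_directed ⟨J₀, hJ₀⟩ hchain.directedOn).1
      (hn a (Finset.mem_cons_self a Y))
    obtain ⟨J'', hJ'', h1, h2⟩ := hchain.directedOn J hJ J' hJ'
    exact ⟨J'', hJ'', Finset.forall_mem_cons _ _ |>.2 ⟨h2 h', fun y hy => h1 (h y hy)⟩⟩

/-- The coarsening of a valuation ring `V` in which `y` becomes topologically nilpotent: the
elements all of whose powers are bounded by `y⁻¹`. -/
def coarsening {K : Type*} [Field K] (V : ValuationSubring K) (y : K) (hy : V.valuation y ≤ 1) :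
    ValuationSubring K where
  carrier := {z | ∀ n : ℕ, V.valuation z ^ n * V.valuation y ≤ 1}
  mul_mem' {a b} ha hb n := by
    -- The condition on the larger factor is then used with the exponent `2 * n`.
    have h : V.valuation (a * b) ≤ max (V.valuation a) (V.valuation b) ^ 2 := by
      rw [map_mul, pow_two]
      exact mul_le_mul' (le_max_left _ _) (le_max_right _ _)
    refine (mul_le_mul_left (pow_le_pow_left₀ zero_le h n) _).trans ?_
    rw [← pow_mul]
    rcases max_choice (V.valuation a) (V.valuation b) with h | h <;> rw [h]
    exacts [ha _, hb _]
  one_mem' n := by rwa [map_one, one_pow, one_mul]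
  add_mem' {a b} ha hb n := by
    refine (mul_le_mul_left (pow_le_pow_left₀ zero_le (V.valuation.map_add a b) n) _).trans ?_
    rcases max_choice (V.valuation a) (V.valuation b) with h | h <;> rw [h]
    exacts [ha _, hb _]
  zero_mem' n := by
    rw [map_zero]
    exact (mul_le_mul_left (pow_le_one₀ zero_le zero_le_one) _).trans (by rwa [one_mul])
  neg_mem' {a} ha n := by
    rw [Valuation.map_neg]
    exact ha n
  mem_or_inv_mem' z := by
    have key : ∀ z ∈ V, ∀ n : ℕ, V.valuation z ^ n * V.valuation y ≤ 1 := fun z hz n =>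
      mul_le_one' (pow_le_one₀ zero_le ((V.valuation_le_one_iff z).2 hz)) hy
    exact (V.mem_or_inv_mem z).imp (key z) (key z⁻¹)

universe u

/-- Take the fraction field of `A ⧸ Q`, for `Q` as in `exists_maximal_pow_notMem`, and a valuation
ring dominating the image of `A`. Maximality of `Q` makes the powers of the largest `y ∈ Y` smaller
than any nonzero element. Coarsening so that every element of the new maximal ideal has a power
smaller than `y` makes the valuation archimedean. -/
theorem exists_valuation {A : Type u} [CommRing A] [IsLocalRing A] (Y : Finset A)
    (hY : ∀ y ∈ Y, ¬ IsUnit y) (I : Ideal A) (hI : ¬ ∃ n : ℕ, ∀ y ∈ Y, y ^ n ∈ I) :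
    ∃ (K : Type u) (_ : Field K) (f : A →+* K) (V : ValuationSubring K),
      (∀ a ∈ I, f a = 0) ∧ (∀ a, V.valuation (f a) ≤ 1) ∧
      (∃ y ∈ Y, f y ≠ 0 ∧ V.valuation (f y) < 1 ∧ ∀ z ∈ Y, V.valuation (f z) ≤ V.valuation (f y)) ∧
      ∀ z w : K, V.valuation z < 1 → w ≠ 0 → ∃ n : ℕ, V.valuation z ^ n ≤ V.valuation w := by
  obtain ⟨Q, hIQ, hQ⟩ := exists_maximal_pow_notMem Y I hI
  have hprime := isPrime_of_maximal_pow_notMem Y Q hQ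
  let K := FractionRing (A ⧸ Q)
  let f : A →+* K := (algebraMap (A ⧸ Q) K).comp (Ideal.Quotient.mk Q)
  have hf : ∀ a, f a = 0 ↔ a ∈ Q := fun a => by
    rw [RingHom.comp_apply, FaithfulSMul.algebraMap_eq_zero_iff, Ideal.Quotient.eq_zero_iff_mem]
  obtain ⟨V, hV, hloc⟩ := IsLocalRing.exists_factor_valuationRing f
  have hle : ∀ a, V.valuation (f a) ≤ 1 := fun a => (V.valuation_le_one_iff _).2 (hV a)
  have hlt : ∀ y ∈ Y, V.valuation (f y) < 1 := fun y hy =>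
    (V.valuation_lt_one_iff ⟨f y, hV y⟩).1 (by
      rw [IsLocalRing.mem_maximalIdeal, mem_nonunits_iff]
      exact fun h => hY y hy (hloc.map_nonunit y h))
  have hne : Y.Nonempty := Finset.nonempty_iff_ne_empty.2 fun h => hI ⟨0, by simp [h]⟩
  obtain ⟨y, hy, hmax⟩ := Y.exists_max_image (fun y => V.valuation (f y)) hne
  have hy0 : f y ≠ 0 := fun h0 => hQ.1 ⟨1, fun z hz => by
    have := hmax z hz
    rw [h0, map_zero, le_zero_iff, map_eq_zero, hf] at this
    rwa [pow_one]⟩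
  have hcof : ∀ w : K, w ≠ 0 → ∃ n : ℕ, V.valuation (f y) ^ n ≤ V.valuation w := by
    intro w hw
    obtain ⟨a, b, hb, rfl⟩ := IsFractionRing.div_surjective (A := A ⧸ Q) w
    obtain ⟨a, rfl⟩ := Ideal.Quotient.mk_surjective a
    obtain ⟨b, rfl⟩ := Ideal.Quotient.mk_surjective b
    change f a / f b ≠ 0 at hw
    change ∃ n : ℕ, _ ≤ V.valuation (f a / f b)
    have ha : a ∉ Q := fun h => (div_ne_zero_iff.1 hw).1 ((hf a).2 h)
    have : ∃ n : ℕ, ∀ y ∈ Y, y ^ n ∈ Q ⊔ Ideal.span {a} := by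
      by_contra h
      exact ha (hQ.2 h le_sup_left (Ideal.mem_sup_right (Ideal.mem_span_singleton_self a)))
    obtain ⟨n, hn⟩ := this
    obtain ⟨q, hq, x, hx, hqx⟩ := Submodule.mem_sup.1 (hn y hy)
    obtain ⟨c, rfl⟩ := Ideal.mem_span_singleton.1 hx
    have h1 : V.valuation (f y) ^ n ≤ V.valuation (f a) := by
      rw [← map_pow, ← map_pow, ← hqx, map_add, (hf q).2 hq, zero_add, map_mul, map_mul]
      exact mul_le_of_le_one_right' (hle c)
    refine ⟨n, h1.trans ?_⟩
    rw [map_div₀, le_div_iff₀ (zero_lt_iff.2 ((map_ne_zero _).2 (div_ne_zero_iff.1 hw).2))]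
    exact mul_le_of_le_one_right' (hle b)
  let V' := coarsening V (f y) (hle y)
  have hVV' : ∀ z, V.valuation z ≤ 1 → V'.valuation z ≤ 1 := fun z hz =>
    (V'.valuation_le_one_iff z).2 fun n => mul_le_one' (pow_le_one₀ zero_le hz) (hle y)
  have hmono : ∀ z w, V.valuation z ≤ V.valuation w → V'.valuation z ≤ V'.valuation w := by
    intro z w h
    rcases eq_or_ne w 0 with rfl | hw
    · rw [map_zero, le_zero_iff, map_eq_zero] at h
      rw [h]
    · have h1 := hVV' (z / w) (by
        rw [map_div₀]
        exact div_le_one_of_le₀ h zero_le)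
      rwa [map_div₀, div_le_one₀ (zero_lt_iff.2 ((map_ne_zero _).2 hw))] at h1
  have hlt' : ∀ z : K, z ≠ 0 → V'.valuation z < 1 → ∃ n : ℕ, V.valuation z ^ n < V.valuation (f y) := by
    intro z hz h
    have h1 : z⁻¹ ∉ V' := by
      rw [← V'.valuation_le_one_iff, map_inv₀, not_le]
      exact (one_lt_inv₀ (zero_lt_iff.2 ((map_ne_zero _).2 hz))).2 h
    by_contra! hn
    refine h1 fun n => ?_
    rw [map_inv₀, inv_pow]
    exact inv_mul_le_one_of_le₀ (hn n) zero_le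
  refine ⟨K, inferInstance, f, V', fun a ha => (hf a).2 (hIQ ha), fun a => hVV' _ (hle a),
    ⟨y, hy, hy0, ?_, fun z hz => hmono _ _ (hmax z hz)⟩, fun z w hz hw => ?_⟩
  · by_contra! h
    have h1 : (f y)⁻¹ ∈ V' := by
      rw [← V'.valuation_le_one_iff, map_inv₀]
      exact inv_le_one_of_one_le₀ h
    -- The exponent `2` in the definition of `coarsening` gives `|y|⁻¹ ≤ 1` for the original
    -- valuation, so `y` stays in the maximal ideal.
    have h2 := h1 2
    have h3 : 0 < V.valuation (f y) := zero_lt_iff.2 ((map_ne_zero _).2 hy0)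
    rw [map_inv₀, pow_two, mul_assoc, inv_mul_cancel₀ h3.ne', mul_one, inv_le_one₀ h3] at h2
    exact (hlt y hy).not_ge h2
  · rcases eq_or_ne z 0 with rfl | hz0
    · exact ⟨1, by rw [map_zero, pow_one]; exact zero_le⟩
    obtain ⟨n, hn⟩ := hlt' z hz0 hz
    obtain ⟨m, hm⟩ := hcof w hw
    refine ⟨n * m, ?_⟩
    rw [← map_pow]
    refine hmono _ _ ?_
    rw [map_pow, pow_mul]
    exact (pow_le_pow_left₀ zero_le hn.le m).trans hm

end IwasawaGL2
-- Kaplansky's lemma: polynomials separating a ball from finitely many points.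
namespace IwasawaGL2

section Kaplansky
variable {K : Type*} [Field K] (V : ValuationSubring K)

theorem valuation_mul_sub_one_lt {a b : K} (ha : V.valuation (a - 1) < 1)
    (hb : V.valuation (b - 1) < 1) : V.valuation (a * b - 1) < 1 := by
  have : a * b - 1 = (a - 1) * (b - 1) + (a - 1) + (b - 1) := by ring
  rw [this]
  refine V.valuation.map_add_lt (V.valuation.map_add_lt ?_ ha) hb
  rw [map_mul]
  exact mul_lt_one_of_nonneg_of_lt_one_left zero_le ha hb.le

theorem valuation_le_one_of_sub_one_lt {a : K} (ha : V.valuation (a - 1) < 1) :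
    V.valuation a ≤ 1 := by
  have := V.valuation.map_add_le ha.le (map_one V.valuation).le
  rwa [sub_add_cancel] at this

theorem valuation_prod_sub_one_lt {ι : Type*} (s : Finset ι) (g : ι → K)
    (h : ∀ i ∈ s, V.valuation (g i - 1) < 1) : V.valuation (∏ i ∈ s, g i - 1) < 1 := by
  refine Finset.prod_induction g (fun a => V.valuation (a - 1) < 1)
    (fun a b => valuation_mul_sub_one_lt V) ?_ h
  rw [sub_self, map_zero]
  exact zero_lt_one

theorem exists_bound_eval (P : Polynomial K) (a : K) :
    ∃ c : K, c ≠ 0 ∧ ∀ z, V.valuation z ≤ V.valuation a → V.valuation (P.eval z) ≤ V.valuation c := by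
  induction P using Polynomial.induction_on' with
  | add P Q hP hQ =>
    obtain ⟨c, hc, h⟩ := hP
    obtain ⟨d, hd, h'⟩ := hQ
    rcases le_total (V.valuation c) (V.valuation d) with hcd | hcd
    · exact ⟨d, hd, fun z hz => by
        rw [Polynomial.eval_add]
        exact V.valuation.map_add_le ((h z hz).trans hcd) (h' z hz)⟩
    · exact ⟨c, hc, fun z hz => by
        rw [Polynomial.eval_add]
        exact V.valuation.map_add_le (h z hz) ((h' z hz).trans hcd)⟩
  | monomial n b =>
    by_cases hb : b * a ^ n = 0
    · refine ⟨1, one_ne_zero, fun z hz => ?_⟩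
      have : V.valuation (b * z ^ n) ≤ V.valuation (b * a ^ n) := by
        rw [map_mul, map_mul, map_pow, map_pow]
        gcongr
      rw [Polynomial.eval_monomial]
      rw [hb, map_zero] at this
      exact this.trans zero_le
    · refine ⟨_, hb, fun z hz => ?_⟩
      rw [Polynomial.eval_monomial, map_mul, map_mul, map_pow, map_pow]
      gcongr

/-- A polynomial that is close to `1` on the ball of radius `|d|` and small near finitely many points
outside this ball. -/
theorem exists_polynomial_separating
    (harch : ∀ z w : K, V.valuation z < 1 → w ≠ 0 → ∃ n : ℕ, V.valuation z ^ n ≤ V.valuation w)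
    (d : K) (Z : Finset K) (hZ : ∀ z ∈ Z, V.valuation d < V.valuation z) :
    ∃ P : Polynomial K,
      (∀ z, V.valuation z ≤ V.valuation d → V.valuation (P.eval z - 1) < 1) ∧
      ∀ a ∈ Z, ∀ z, V.valuation (z - a) ≤ V.valuation d → V.valuation (P.eval z) < 1 := by
  classical
  induction Z using Finset.induction_on_max_value V.valuation with
  | empty => exact ⟨1, by simp, by simp⟩
  | insert a s ha hmax ih =>
    obtain ⟨P, h1, h2⟩ := ih fun z hz => hZ z (Finset.mem_insert_of_mem hz)
    have had : V.valuation d < V.valuation a := hZ a (Finset.mem_insert_self a s)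
    have hva : 0 < V.valuation a := zero_le.trans_lt had
    have ha0 : a ≠ 0 := (map_ne_zero V.valuation).1 hva.ne'
    obtain ⟨c, hc, hbd⟩ := exists_bound_eval V P a
    have hda : V.valuation (d / a) < 1 := by
      rwa [map_div₀, div_lt_one₀ hva]
    obtain ⟨m, hm⟩ := harch (d / a) c⁻¹ hda (inv_ne_zero hc)
    have hq : ∀ z, (1 - Polynomial.C a⁻¹ * Polynomial.X : Polynomial K).eval z = 1 - z / a := fun z => by
      rw [Polynomial.eval_sub, Polynomial.eval_one, Polynomial.eval_mul, Polynomial.eval_C,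
        Polynomial.eval_X, div_eq_inv_mul]
    have hq1 : ∀ z, V.valuation z ≤ V.valuation a → V.valuation (1 - z / a) ≤ 1 := fun z hz => by
      refine V.valuation.map_sub_le (map_one _).le ?_
      rw [map_div₀]
      exact div_le_one_of_le₀ hz zero_le
    -- The new factor is near `1` on the ball of radius `|d| < |a|`, has size at most `|d / a| ^ (m
    -- + 1)` near `a`, and is bounded by `1` near the other points, since `a` is the largest. The
    -- `m` factors absorb the bound `c` for `P`; the extra one makes the inequality strict.
    refine ⟨P * (1 - Polynomial.C a⁻¹ * Polynomial.X) ^ (m + 1), fun z hz => ?_, fun b hb z hz => ?_⟩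
    · rw [Polynomial.eval_mul, Polynomial.eval_pow, hq]
      refine valuation_mul_sub_one_lt V (h1 z hz) ?_
      rw [← Finset.card_range (m + 1), ← Finset.prod_const]
      refine valuation_prod_sub_one_lt V _ _ fun _ _ => ?_
      rw [sub_sub_cancel_left, Valuation.map_neg, map_div₀, div_lt_one₀ hva]
      exact hz.trans_lt had
    · rw [Polynomial.eval_mul, Polynomial.eval_pow, hq, map_mul, map_pow]
      rcases Finset.mem_insert.1 hb with rfl | hb
      · have hzb : V.valuation z ≤ V.valuation b := by
          have := V.valuation.map_add_le (hz.trans had.le) le_rfl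
          rwa [sub_add_cancel] at this
        have h3 : V.valuation (1 - z / b) ≤ V.valuation (d / b) := by
          rw [one_sub_div ha0, map_div₀, map_div₀, Valuation.map_sub_swap]
          gcongr
        have hvc : 0 < V.valuation c := zero_lt_iff.2 ((map_ne_zero _).2 hc)
        calc V.valuation (P.eval z) * V.valuation (1 - z / b) ^ (m + 1)
            ≤ V.valuation c * V.valuation (d / b) ^ (m + 1) := by
              gcongr
              exact hbd z hzb
          _ = V.valuation c * V.valuation (d / b) ^ m * V.valuation (d / b) := by
              rw [pow_succ, mul_assoc]
          _ ≤ 1 * V.valuation (d / b) := by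
              rw [map_inv₀] at hm
              gcongr
              exact (mul_le_mul_right hm _).trans (mul_inv_cancel₀ hvc.ne').le
          _ < 1 := by rwa [one_mul]
      · have hza : V.valuation z ≤ V.valuation a := by
          have := V.valuation.map_add_le (hz.trans had.le) (hmax b hb)
          rwa [sub_add_cancel] at this
        exact mul_lt_one_of_nonneg_of_lt_one_left zero_le (h2 b hb z hz)
          (pow_le_one₀ zero_le (hq1 z hza))

end Kaplansky

/-! ### Coset representatives and coefficients at finite level. -/

section
open IwasawaAlgebra

theorem PowerFiltration.exists_finset_reps {p : ℕ} {H : Type*} [CommGroup H] [TopologicalSpace H]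
    (L : PowerFiltration p H) (n : ℕ) : ∃ R : Finset H, ∀ t, ∃ r ∈ R, ∃ u ∈ L.level n, t = r * u := by
  classical
  induction n with
  | zero => exact ⟨{1}, fun t => ⟨1, Finset.mem_singleton_self 1, t,
      by simpa using L.pow_mem_level 0 t, (one_mul t).symm⟩⟩
  | succ n ih =>
    obtain ⟨R, hR⟩ := ih
    refine ⟨Finset.image₂ (fun e r => e * r ^ p) L.reps R, fun t => ?_⟩
    obtain ⟨e, he, s, rfl⟩ := L.exists_rep t
    obtain ⟨r, hr, u, hu, rfl⟩ := hR s
    obtain ⟨w, rfl⟩ := (L.mem_level n u).1 hu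
    refine ⟨_, Finset.mem_image₂_of_mem he hr, w ^ p ^ (n + 1), L.pow_mem_level _ w, ?_⟩
    rw [mul_pow, ← pow_mul, ← pow_succ, mul_assoc]

theorem coeff_transition {E H : Type*} [Field E] [CommGroup H] [TopologicalSpace H]
    {V V' : OpenSubgroup H} (h : V ≤ V') (q : H ⧸ (V' : Subgroup H))
    [DecidableEq (H ⧸ (V' : Subgroup H))]
    (x : MonoidAlgebra E (H ⧸ (V : Subgroup H))) :
    (transition E h x).coeff q =
      x.coeff.sum fun g c => if (g.out : H ⧸ (V' : Subgroup H)) = q then c else 0 := by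
  induction x using MonoidAlgebra.induction_linear with
  | zero => simp
  | add x y hx hy =>
    rw [map_add, MonoidAlgebra.coeff_add, Finsupp.add_apply, hx, hy, MonoidAlgebra.coeff_add,
      Finsupp.sum_add_index']
    · simp
    · intro g a b
      split_ifs <;> simp
  | single g c =>
    rw [MonoidAlgebra.coeff_single, Finsupp.sum_single_index (by simp)]
    conv_lhs => rw [← QuotientGroup.out_eq' g, transition_single, MonoidAlgebra.coeff_single,
      Finsupp.single_apply]

theorem sum_single_out {E H : Type*} [Field E] [CommGroup H] [TopologicalSpace H]
    (V : OpenSubgroup H) (x : MonoidAlgebra E (H ⧸ (V : Subgroup H))) :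
    proj V (x.coeff.sum fun g c => c • (of g.out : IwasawaAlgebra E H)) = x := by
  induction x using MonoidAlgebra.induction_linear with
  | zero => simp
  | add x y hx hy =>
    rw [MonoidAlgebra.coeff_add, Finsupp.sum_add_index' (by simp) (fun g a b => add_smul a b _),
      map_add, hx, hy]
  | single g c =>
    rw [MonoidAlgebra.coeff_single, Finsupp.sum_single_index (by simp), map_smul, proj_of,
      MonoidAlgebra.smul_single, smul_eq_mul, mul_one, QuotientGroup.out_eq']

end
end IwasawaGL2
-- Riemann sums against elements of the Iwasawa algebra.
namespace IwasawaGL2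
open IwasawaAlgebra

theorem valuation_le_of_mem_span {A K : Type*} [CommRing A] [Field K] (V : ValuationSubring K)
    (g : A →+* K) (hg : ∀ a, V.valuation (g a) ≤ 1) (G : Set A) (γ : V.ValueGroup)
    (hG : ∀ s ∈ G, V.valuation (g s) ≤ γ) (z : A) (hz : z ∈ Ideal.span G) :
    V.valuation (g z) ≤ γ := by
  induction hz using Submodule.span_induction with
  | mem s hs => exact hG s hs
  | zero => rw [map_zero, map_zero]; exact zero_le
  | add x y _ _ hx hy => rw [map_add]; exact V.valuation.map_add_le hx hy
  | smul a x _ hx =>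
    rw [smul_eq_mul, map_mul, map_mul]
    exact (mul_le_mul_left (hg a) _).trans (by rwa [one_mul])

section Core
universe u v w
variable {E : Type u} {H : Type v} [Field E] [CommGroup H] [TopologicalSpace H]
  {p : ℕ} (L : PowerFiltration p H) [Fact p.Prime] [CharP E p]
  {K : Type w} [Field K] (V : ValuationSubring K) (f : IwasawaAlgebra E H →+* K)
  (hf : ∀ a, V.valuation (f a) ≤ 1) (η : K)
  (hη : ∀ e ∈ L.reps, V.valuation (f (of e - 1)) ≤ V.valuation η)

/-- The group homomorphism underlying a homomorphism out of `E[[H]]`. -/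
noncomputable def chi : H →* K := f.toMonoidHom.comp of

theorem chi_apply (h : H) : chi f h = f (of h) := rfl

include L hf hη

/-- The element `[h] - 1` lies in the ideal generated by the `[e] - 1`, and `f` has integral values;
no continuity of `f` is involved. -/
theorem valuation_chi_sub_one_le (h : H) : V.valuation (chi f h - 1) ≤ V.valuation η := by
  have h1 := L.mem_span_of_proj_eq_zero 0 (of h - 1 : IwasawaAlgebra E H) (by
    rw [map_sub, proj_of, map_one, (QuotientGroup.eq_one_iff h).2 (by
      simpa using L.pow_mem_level 0 h)]
    exact sub_self _)
  have h2 := valuation_le_of_mem_span V f hf _ (V.valuation η) ?_ _ h1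
  · rwa [map_sub, map_one] at h2
  · rintro _ ⟨e, he, rfl⟩
    simpa using hη e he

theorem valuation_chi_sub_one_le_of_mem_level (n : ℕ) (h : H) (hh : h ∈ L.level n) :
    V.valuation (chi f h - 1) ≤ V.valuation η ^ p ^ n := by
  obtain ⟨t, rfl⟩ := (L.mem_level n h).1 hh
  rw [chi_apply, ← map_one f, ← map_sub, ← of_sub_one_pow, map_pow, map_pow, map_sub, map_one,
    ← chi_apply]
  exact pow_le_pow_left₀ zero_le (valuation_chi_sub_one_le L V f hf η hη t) _

theorem valuation_map_le_of_proj_eq_zero (n : ℕ) (θ : H →* H) (hθ : Continuous θ)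
    (z : IwasawaAlgebra E H) (hz : proj (L.level n) z = 0) :
    V.valuation (f (IwasawaAlgebra.map θ hθ z)) ≤ V.valuation η ^ p ^ n := by
  refine valuation_le_of_mem_span V (f.comp (IwasawaAlgebra.map θ hθ).toRingHom)
    (fun a => hf _) _ _ ?_ _ (L.mem_span_of_proj_eq_zero n z hz)
  rintro _ ⟨e, -, rfl⟩
  change V.valuation (f (IwasawaAlgebra.map θ hθ (of (e ^ p ^ n) - 1))) ≤ _
  rw [map_sub, map_one, map_of, map_pow, map_sub, map_one, ← chi_apply]
  exact valuation_chi_sub_one_le_of_mem_level L V f hf η hη n _ (L.pow_mem_level n _)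

omit L hf hη in
/-- The sum approximating the integral of `φ` with respect to an element of `E[H/V]`. -/
noncomputable def riemannSum {U : OpenSubgroup H} (x : MonoidAlgebra E (H ⧸ (U : Subgroup H)))
    (φ : H → K) : K :=
  x.coeff.sum fun g c => f (algebraMap E _ c) * φ g.out

/-- The Riemann sum is the value of `f` on the twist of a finite combination of group elements that
agrees with `x` at level `n`. The twist of `x` itself goes to zero, so the sum is bounded by the
size of `f` on the twisted kernel. -/
theorem valuation_riemannSum_chi_le (n : ℕ) (θ : H →* H) (hθ : Continuous θ)
    (x : IwasawaAlgebra E H) (hx : f (IwasawaAlgebra.map θ hθ x) = 0) :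
    V.valuation (riemannSum f (proj (L.level n) x) (fun h => chi f (θ h))) ≤
      V.valuation η ^ p ^ n := by
  set ξ := proj (L.level n) x with hξ
  have h1 := valuation_map_le_of_proj_eq_zero L V f hf η hη n θ hθ
    (x - ξ.coeff.sum fun g c => c • (of g.out : IwasawaAlgebra E H))
    (by rw [map_sub, sum_single_out, sub_self])
  rw [map_sub, map_sub, hx, zero_sub, Valuation.map_neg] at h1
  convert h1 using 2
  rw [riemannSum, Finsupp.sum, Finsupp.sum, map_sum, map_sum]
  refine Finset.sum_congr rfl fun g _ => ?_
  rw [map_smul, map_of, Algebra.smul_def, map_mul, chi_apply]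

/-- If the twists of `x` by the endomorphisms in `S` are killed by `f`, then the integral against
`x` of any linear combination of the functions `chi ∘ θ`, for `θ ∈ S`, vanishes. -/
theorem valuation_riemannSum_le (S : Submonoid (H →* H)) (hS : ∀ θ ∈ S, Continuous θ)
    (x : IwasawaAlgebra E H) (hx : ∀ θ (h : θ ∈ S), f (IwasawaAlgebra.map θ (hS θ h) x) = 0)
    (φ : H → K) (hφ : φ ∈ Submodule.span K {ψ | ∃ θ ∈ S, ψ = fun h => chi f (θ h)}) :
    ∃ c : K, c ≠ 0 ∧ ∀ n, V.valuation (riemannSum f (proj (L.level n) x) φ) ≤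
      V.valuation c * V.valuation η ^ p ^ n := by
  induction hφ using Submodule.span_induction with
  | mem ψ hψ =>
    obtain ⟨θ, hθ, rfl⟩ := hψ
    refine ⟨1, one_ne_zero, fun n => ?_⟩
    rw [map_one, one_mul]
    exact valuation_riemannSum_chi_le L V f hf η hη n θ (hS θ hθ) x (hx θ hθ)
  | zero => exact ⟨1, one_ne_zero, fun n => by simp [riemannSum]⟩
  | add φ ψ _ _ h1 h2 =>
    obtain ⟨c, hc, h1⟩ := h1
    obtain ⟨d, hd, h2⟩ := h2
    have hadd : ∀ n, riemannSum f (proj (L.level n) x) (φ + ψ) =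
        riemannSum f (proj (L.level n) x) φ + riemannSum f (proj (L.level n) x) ψ := fun n => by
      simp only [riemannSum, Pi.add_apply, mul_add, Finsupp.sum_add]
    rcases le_total (V.valuation c) (V.valuation d) with hcd | hcd
    · refine ⟨d, hd, fun n => ?_⟩
      rw [hadd]
      exact V.valuation.map_add_le ((h1 n).trans (mul_le_mul_left hcd _)) (h2 n)
    · refine ⟨c, hc, fun n => ?_⟩
      rw [hadd]
      exact V.valuation.map_add_le (h1 n) ((h2 n).trans (mul_le_mul_left hcd _))
  | smul a φ _ h1 =>
    obtain ⟨c, hc, h1⟩ := h1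
    have hmul : ∀ n, riemannSum f (proj (L.level n) x) (a • φ) =
        a * riemannSum f (proj (L.level n) x) φ := fun n => by
      simp only [riemannSum, Pi.smul_apply, smul_eq_mul, Finsupp.mul_sum, mul_left_comm]
    by_cases ha : a = 0
    · refine ⟨1, one_ne_zero, fun n => ?_⟩
      rw [hmul, ha, zero_mul, map_zero]
      exact zero_le
    · refine ⟨a * c, mul_ne_zero ha hc, fun n => ?_⟩
      rw [hmul, map_mul, map_mul, mul_assoc]
      exact mul_le_mul_right (h1 n) _

omit L hf hη in
-- The product in `H →* H` is pointwise, so the functions `χ ∘ θ` form a multiplicative monoid and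
-- their span is an algebra. Translation by `s` only rescales each of them by `χ (θ s)`.
theorem prod_aeval_mem_span (S : Submonoid (H →* H)) (T : Finset (H →* H)) (hT : ∀ θ ∈ T, θ ∈ S)
    (P : Polynomial K) (s : H) :
    (fun h => ∏ θ ∈ T, P.eval (chi f (θ (h * s)) - 1)) ∈
      Submodule.span K {ψ : H → K | ∃ θ ∈ S, ψ = fun h => chi f (θ h)} := by
  let M : Submonoid (H → K) :=
    { carrier := {ψ | ∃ θ ∈ S, ψ = fun h => chi f (θ h)}
      one_mem' := ⟨1, S.one_mem, funext fun h => by simp⟩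
      mul_mem' := by
        rintro _ _ ⟨θ, hθ, rfl⟩ ⟨θ', hθ', rfl⟩
        exact ⟨θ * θ', S.mul_mem hθ hθ', funext fun h => by simp⟩ }
  have hM : Subalgebra.toSubmodule (Algebra.adjoin K (M : Set (H → K))) =
      Submodule.span K {ψ : H → K | ∃ θ ∈ S, ψ = fun h => chi f (θ h)} := by
    rw [Algebra.adjoin_eq_span, Submonoid.closure_eq]
    rfl
  rw [← hM, Subalgebra.mem_toSubmodule]
  have key : ∀ θ ∈ T, (fun h => P.eval (chi f (θ (h * s)) - 1)) ∈
      Algebra.adjoin K (M : Set (H → K)) := by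
    intro θ hθ
    have h1 : (chi f (θ s) • (fun h => chi f (θ h)) - 1 : H → K) ∈
        Algebra.adjoin K (M : Set (H → K)) :=
      sub_mem (Subalgebra.smul_mem _ (Algebra.subset_adjoin
        (show _ ∈ (M : Set (H → K)) from ⟨θ, hT θ hθ, rfl⟩)) _) (one_mem _)
    have h2 : (fun h => P.eval (chi f (θ (h * s)) - 1)) =
        Polynomial.aeval (chi f (θ s) • (fun h => chi f (θ h)) - 1 : H → K) P := by
      funext h
      rw [Polynomial.aeval_pi_apply₂, Polynomial.coe_aeval_eq_eval]
      simp [mul_comm]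
    rw [h2]
    exact Algebra.adjoin_le (Set.singleton_subset_iff.2 h1)
      (Polynomial.aeval_mem_adjoin_singleton K _)
  have h3 : (fun h => ∏ θ ∈ T, P.eval (chi f (θ (h * s)) - 1)) =
      ∏ θ ∈ T, fun h => P.eval (chi f (θ (h * s)) - 1) := by
    funext h
    rw [Finset.prod_apply]
  rw [h3]
  exact Subalgebra.prod_mem _ key

end Core
end IwasawaGL2
-- Nilpotence of the augmentation ideal modulo an ideal containing all twists.
namespace IwasawaGL2
open IwasawaAlgebra

section
universe u v
variable {E : Type u} {H : Type v} [Field E] [CommGroup H] [TopologicalSpace H]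
  {p : ℕ} (L : PowerFiltration p H) [Fact p.Prime] [CharP E p]

theorem valuation_algebraMap_eq_one {A K : Type*} [CommRing A] [Algebra E A] [Field K]
    (V : ValuationSubring K) (f : A →+* K) (hf : ∀ a, V.valuation (f a) ≤ 1) (c : E) (hc : c ≠ 0) :
    V.valuation (f (algebraMap E A c)) = 1 := by
  refine le_antisymm (hf _) ?_
  have h := hf (algebraMap E A c⁻¹)
  have hne : f (algebraMap E A c) ≠ 0 := fun h0 => by
    have : f (algebraMap E A (c * c⁻¹)) = 0 := by rw [map_mul, map_mul, h0, zero_mul]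
    rw [mul_inv_cancel₀ hc, map_one, map_one] at this
    exact one_ne_zero this
  have h2 : f (algebraMap E A c⁻¹) = (f (algebraMap E A c))⁻¹ := by
    refine eq_inv_of_mul_eq_one_left ?_
    rw [← map_mul, ← map_mul, inv_mul_cancel₀ hc, map_one, map_one]
  rw [h2, map_inv₀, inv_le_one₀ (zero_lt_iff.2 ((map_ne_zero _).2 hne))] at h
  exact h

/-- An element of `E[[H]]` that has a nonzero coefficient at a coset of `U` has an integral of
absolute value one against any function close to the characteristic function of this coset. -/
theorem valuation_riemannSum_eq_one {K : Type*} [Field K] (V : ValuationSubring K)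
    (f : IwasawaAlgebra E H →+* K) (hf : ∀ a, V.valuation (f a) ≤ 1) {U U' : OpenSubgroup H}
    (h : U' ≤ U) (x : IwasawaAlgebra E H) (s : H)
    (hs : (proj U x).coeff (s : H ⧸ (U : Subgroup H)) ≠ 0) (φ : H → K)
    (h1 : ∀ g, g * s⁻¹ ∈ U → V.valuation (φ g - 1) < 1)
    (h2 : ∀ g, g * s⁻¹ ∉ U → V.valuation (φ g) < 1) :
    V.valuation (riemannSum f (proj U' x) φ) = 1 := by
  classical
  -- The coefficient at the coset is the integral of its exact characteristic function; replacing
  -- that function by `φ` changes the value only by an element of the maximal ideal.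
  have hc : f (algebraMap E _ ((proj U x).coeff (s : H ⧸ (U : Subgroup H)))) =
      (proj U' x).coeff.sum fun g c => f (algebraMap E _ c) *
        if g.out * s⁻¹ ∈ U then 1 else 0 := by
    rw [← transition_proj h, coeff_transition, Finsupp.sum, Finsupp.sum, map_sum, map_sum]
    refine Finset.sum_congr rfl fun g _ => ?_
    have : (g.out : H ⧸ (U : Subgroup H)) = s ↔ g.out * s⁻¹ ∈ U := by
      rw [eq_comm, QuotientGroup.eq, mul_comm]
      rfl
    by_cases hg : g.out * s⁻¹ ∈ U
    · rw [if_pos (this.2 hg), if_pos hg, mul_one]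
    · rw [if_neg (mt this.1 hg), if_neg hg, mul_zero, map_zero, map_zero]
  have hlt : V.valuation (riemannSum f (proj U' x) φ -
      f (algebraMap E _ ((proj U x).coeff (s : H ⧸ (U : Subgroup H))))) < 1 := by
    rw [hc, riemannSum, ← Finsupp.sum_sub]
    refine V.valuation.map_sum_lt one_ne_zero fun g _ => ?_
    beta_reduce
    rw [← mul_sub, map_mul]
    refine (mul_le_mul_left (hf _) _).trans_lt ?_
    rw [one_mul]
    split_ifs with hg
    · exact h1 _ hg
    · rw [sub_zero]
      exact h2 _ hg
  have hone := valuation_algebraMap_eq_one V f hf _ hs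
  have := V.valuation.map_add_eq_of_lt_left (hlt.trans_eq hone.symm)
  rw [add_sub_cancel, hone] at this
  exact this

/-- If a nonzero `x ∈ E[[H]]` and its twists by a set `S` of endomorphisms of `H` that is closed under
pointwise multiplication lie in a common ideal `I`, and if `S` moves any element outside
`H ^ p ^ n` to any given `p ^ n`-th power, then the augmentation ideal is nilpotent modulo `I`. -/
theorem exists_pow_mem_of_map_mem [IsTopologicalGroup H] (S : Submonoid (H →* H))
    (hS : ∀ θ ∈ S, Continuous θ)
    (htrans : ∀ (e s : H) (n : ℕ), s ∉ L.level n → ∃ θ ∈ S, θ s = e ^ p ^ n)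
    (I : Ideal (IwasawaAlgebra E H)) (x : IwasawaAlgebra E H) (hx0 : x ≠ 0)
    (hx : ∀ θ (h : θ ∈ S), IwasawaAlgebra.map θ (hS θ h) x ∈ I) :
    ∃ n : ℕ, ∀ e ∈ L.reps, (of e - 1) ^ n ∈ I := by
  classical
  by_contra hI
  have := L.isLocalRing E
  obtain ⟨K, _, f, V, hfI, hf, ⟨y, hyY, hy0, hy1, hymax⟩, harch⟩ :=
    exists_valuation (L.reps.image fun e => (of e - 1 : IwasawaAlgebra E H)) (by
      intro y hy hu
      obtain ⟨e, -, rfl⟩ := Finset.mem_image.1 hy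
      have := hu.map (aug : IwasawaAlgebra E H →ₐ[E] E)
      rw [map_sub, map_one, aug_of, sub_self] at this
      exact not_isUnit_zero this) I (by simpa using hI)
  obtain ⟨e₀, he₀, rfl⟩ := Finset.mem_image.1 hyY
  set η := f (of e₀ - 1) with hη_def
  have hη : ∀ e ∈ L.reps, V.valuation (f (of e - 1)) ≤ V.valuation η := fun e he =>
    hymax _ (Finset.mem_image_of_mem _ he)
  have hη0 : 0 < V.valuation η := zero_lt_iff.2 ((map_ne_zero _).2 hy0)
  have hχ0 : ∀ h, chi f h - 1 = f (of h - 1) := fun h => by rw [map_sub, map_one, chi_apply]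
  obtain ⟨n, hn⟩ : ∃ n, proj (L.level n) x ≠ 0 := by
    by_contra! h
    exact hx0 (L.ext_level fun n => by rw [h, map_zero])
  -- The radius is chosen so that `|η| ^ p ^ (n + 1) ≤ |d| < |η| ^ p ^ n`: up to `d`, `χ` is
  -- constant on cosets of level `n + 1`, yet `e₀ ^ p ^ n` is still distinguished from `1`.
  set d := η ^ (p ^ n + 1) with hd
  have hdlt : V.valuation d < V.valuation η ^ p ^ n := by
    rw [hd, map_pow, pow_succ]
    exact mul_lt_of_lt_one_right (pow_pos hη0 _) hy1
  have hlevel : ∀ h g, g ∈ L.level (n + 1) → V.valuation (chi f (h * g) - chi f h) ≤ V.valuation d := by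
    intro h g hg
    have h1 := valuation_chi_sub_one_le_of_mem_level L V f hf η hη (n + 1) g hg
    rw [map_mul, ← mul_sub_one, map_mul]
    refine (mul_le_mul' (hf _) h1).trans ?_
    rw [one_mul, hd, map_pow]
    refine pow_le_pow_of_le_one zero_le hy1.le ?_
    have h2 : p ^ n < p ^ (n + 1) := Nat.pow_lt_pow_right (Nat.Prime.one_lt Fact.out) (Nat.lt_succ_self n)
    omega
  obtain ⟨R, hR⟩ := L.exists_finset_reps (n + 1)
  -- Up to `d`, `χ - 1` takes finitely many values, so a polynomial that is small near those outside
  -- the ball is small at every value outside it.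
  let Z : Finset K := (R.image fun r => chi f r - 1).filter fun z => V.valuation d < V.valuation z
  obtain ⟨P, hP1, hP2⟩ := exists_polynomial_separating V harch d Z
    (fun z hz => (Finset.mem_filter.1 hz).2)
  have hP : ∀ h, V.valuation d < V.valuation (chi f h - 1) → V.valuation (P.eval (chi f h - 1)) < 1 := by
    intro h hh
    obtain ⟨r, hr, u, hu, rfl⟩ := hR h
    have h1 := hlevel r u hu
    refine hP2 (chi f r - 1) (Finset.mem_filter.2 ⟨Finset.mem_image_of_mem _ hr, ?_⟩) _ (by
      rwa [sub_sub_sub_cancel_right])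
    by_contra! h2
    refine hh.not_ge ?_
    have := V.valuation.map_add_le h1 h2
    rwa [sub_add_sub_cancel] at this
  have hchoose : ∀ r, ∃ θ ∈ S, r ∉ L.level n → θ r = e₀ ^ p ^ n := fun r => by
    by_cases hr : r ∈ L.level n
    · exact ⟨1, S.one_mem, fun h => absurd hr h⟩
    · obtain ⟨θ, hθ, h⟩ := htrans e₀ r n hr
      exact ⟨θ, hθ, fun _ => h⟩
  choose θ hθS hθ using hchoose
  let T : Finset (H →* H) := R.image θ
  have hT : ∀ τ ∈ T, τ ∈ S := fun τ hτ => by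
    obtain ⟨r, -, rfl⟩ := Finset.mem_image.1 hτ
    exact hθS r
  -- The elements that the characters `χ ∘ τ`, for `τ ∈ T`, do not distinguish from `1` at radius
  -- `|d|`. Since `T` contains maps sending each `r` outside level `n` to `e₀ ^ p ^ n`, this
  -- subgroup lies inside level `n`, where `x` is visible.
  let B₀ : Subgroup H :=
    { carrier := {s | ∀ τ ∈ T, V.valuation (chi f (τ s) - 1) ≤ V.valuation d}
      one_mem' := fun τ _ => by
        rw [map_one, map_one, sub_self, map_zero]
        exact zero_le
      mul_mem' := fun {a b} ha hb τ hτ => by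
        have : chi f (τ (a * b)) - 1 = chi f (τ a) * (chi f (τ b) - 1) + (chi f (τ a) - 1) := by
          rw [map_mul, map_mul]
          ring
        rw [this]
        refine V.valuation.map_add_le ?_ (ha τ hτ)
        rw [map_mul]
        exact (mul_le_mul_left (hf _) _).trans (by rw [one_mul]; exact hb τ hτ)
      inv_mem' := fun {a} ha τ hτ => by
        have h1 : chi f (τ a⁻¹) * chi f (τ a) = 1 := by
          rw [← map_mul, ← map_mul, inv_mul_cancel, map_one, map_one]
        have : chi f (τ a⁻¹) - 1 = -(chi f (τ a⁻¹) * (chi f (τ a) - 1)) := by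
          rw [mul_sub, h1, mul_one, neg_sub]
        rw [this, Valuation.map_neg, map_mul]
        exact (mul_le_mul_left (hf _) _).trans (by rw [one_mul]; exact ha τ hτ) }
  have hle : (L.level (n + 1) : Subgroup H) ≤ B₀ := fun u hu τ _ => by
    obtain ⟨t, rfl⟩ := (L.mem_level _ u).1 hu
    have := hlevel 1 _ (L.pow_mem_level (n + 1) (τ t))
    rwa [one_mul, map_one, ← map_pow] at this
  let B : OpenSubgroup H := ⟨B₀, Subgroup.isOpen_mono hle (L.level (n + 1)).isOpen⟩
  have hBn : B ≤ L.level n := by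
    intro s hs
    by_contra hsn
    obtain ⟨r, hr, u, hu, rfl⟩ := hR s
    have hrn : r ∉ L.level n := fun h =>
      hsn (mul_mem h (L.level_anti (Nat.le_succ n) hu))
    have h1 := hs (θ r) (Finset.mem_image_of_mem _ hr)
    obtain ⟨t, rfl⟩ := (L.mem_level _ u).1 hu
    have h2 := hlevel (θ r r) _ (L.pow_mem_level (n + 1) (θ r t))
    rw [← map_pow, ← map_mul] at h2
    have h3 := V.valuation.map_sub_le h1 h2
    rw [sub_sub_sub_cancel_left, hθ r hrn, hχ0, ← of_sub_one_pow, map_pow, map_pow] at h3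
    exact h3.not_gt hdlt
  have hB0 : proj B x ≠ 0 := fun h => hn (proj_eq_zero_of_le hBn h)
  obtain ⟨q, hq⟩ : ∃ q, (proj B x).coeff q ≠ 0 := by
    by_contra! h
    exact hB0 (MonoidAlgebra.ext (Finsupp.ext h))
  obtain ⟨s, rfl⟩ := QuotientGroup.mk_surjective q
  -- On the coset of `s` every factor is close to `1`; off it some factor is in the maximal ideal
  -- and the others are integral.
  let φ : H → K := fun h => ∏ τ ∈ T, P.eval (chi f (τ (h * s⁻¹)) - 1)
  obtain ⟨c, hc, hbound⟩ := valuation_riemannSum_le L V f hf η hη S hS x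
    (fun τ hτ => hfI _ (hx τ hτ)) φ (prod_aeval_mem_span f S T hT P s⁻¹)
  obtain ⟨m, hm⟩ := harch η c⁻¹ hy1 (inv_ne_zero hc)
  -- Level `n + 1` ensures containment in `B`; level `m + 1` makes the bound on the Riemann sum
  -- smaller than one.
  have hle' : L.level (max (n + 1) (m + 1)) ≤ B := fun g hg => hle (L.level_anti (le_max_left _ _) hg)
  have hone := valuation_riemannSum_eq_one V f hf hle' x s hq φ
    (fun g hg => valuation_prod_sub_one_lt V T _ fun τ hτ => hP1 _ (hg τ hτ)) (fun g hg => by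
      have hg' : ¬ ∀ τ ∈ T, V.valuation (chi f (τ (g * s⁻¹)) - 1) ≤ V.valuation d := hg
      push Not at hg'
      obtain ⟨τ, hτ, hlt⟩ := hg'
      change V.valuation (∏ τ ∈ T, P.eval (chi f (τ (g * s⁻¹)) - 1)) < 1
      rw [← Finset.mul_prod_erase _ _ hτ, map_mul]
      refine mul_lt_one_of_nonneg_of_lt_one_left zero_le (hP _ hlt) ?_
      rw [map_prod]
      refine Finset.prod_le_one' fun σ _ => ?_
      rcases le_or_gt (V.valuation (chi f (σ (g * s⁻¹)) - 1)) (V.valuation d) with h | h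
      · exact valuation_le_one_of_sub_one_lt V (hP1 _ h)
      · exact (hP _ h).le)
  have := hbound (max (n + 1) (m + 1))
  rw [hone] at this
  refine this.not_gt ?_
  have hvc : 0 < V.valuation c := zero_lt_iff.2 ((map_ne_zero _).2 hc)
  have hexp : m + 1 ≤ p ^ max (n + 1) (m + 1) :=
    (le_max_right _ _).trans (Nat.lt_pow_self (Nat.Prime.one_lt Fact.out)).le
  calc V.valuation c * V.valuation η ^ p ^ max (n + 1) (m + 1)
      ≤ V.valuation c * V.valuation η ^ (m + 1) :=
        mul_le_mul_right (pow_le_pow_of_le_one zero_le hy1.le hexp) _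
    _ = V.valuation c * V.valuation η ^ m * V.valuation η := by rw [pow_succ, mul_assoc]
    _ ≤ 1 * V.valuation η := by
        rw [map_inv₀] at hm
        exact mul_le_mul_left ((mul_le_mul_right hm _).trans (mul_inv_cancel₀ hvc.ne').le) _
    _ < 1 := by rwa [one_mul]

end
end IwasawaGL2
-- Norms on `p`-adic fields, and irreducible representations of commutative groups.
namespace IwasawaGL2

section Padic
variable (p : ℕ) [Fact p.Prime] (F : Type*) [NormedField F] [NormedAlgebra ℚ_[p] F]

theorem norm_prime : ‖(p : F)‖ = (p : ℝ)⁻¹ := by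
  rw [← map_natCast (algebraMap ℚ_[p] F) p, norm_algebraMap', Padic.norm_p]

theorem prime_ne_zero : (p : F) ≠ 0 := by
  rw [← norm_ne_zero_iff, norm_prime]
  exact inv_ne_zero (Nat.cast_ne_zero.2 (Nat.Prime.ne_zero Fact.out))

variable {p F} [FiniteDimensional ℚ_[p] F]

/-- The norm is the spectral norm, which is at most one exactly when the minimal polynomial has
coefficients in `ℤ_p`; any monic integral equation gives the same bound. -/
theorem mem_ringOfIntegers_iff {x : F} : x ∈ ringOfIntegers p F ↔ ‖x‖ ≤ 1 := by
  have halg : Algebra.IsAlgebraic ℚ_[p] F := Algebra.IsAlgebraic.of_finite _ _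
  have hmap : (algebraMap ℚ_[p] F).comp (PadicInt.subring p).subtype =
      algebraMap (PadicInt.subring p) F := rfl
  rw [NormedAlgebra.norm_eq_spectralNorm ℚ_[p]]
  constructor
  · rintro ⟨P, hP, hx⟩
    have hP' := hP.map (PadicInt.subring p).subtype
    have h1 : spectralNorm ℚ_[p] F x ≤ spectralValue (P.map (PadicInt.subring p).subtype) :=
      norm_root_le_spectralValue (f := spectralAlgNorm ℚ_[p] F) isPowMul_spectralNorm
        isNonarchimedean_spectralNorm hP' (by
          rw [Polynomial.aeval_def, Polynomial.eval₂_map, hmap]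
          exact hx)
    refine h1.trans ((spectralValue_le_one_iff hP').2 fun n => ?_)
    rw [Polynomial.coeff_map]
    exact (P.coeff n).2
  · intro hx
    have hmon := minpoly.monic (halg.isAlgebraic x).isIntegral
    rw [spectralNorm, spectralValue_le_one_iff hmon] at hx
    have hc : (↑(minpoly ℚ_[p] x).coeffs : Set ℚ_[p]) ⊆ PadicInt.subring p := fun c hc => by
      obtain ⟨n, -, rfl⟩ := Polynomial.mem_coeffs_iff.1 hc
      exact hx n
    refine ⟨(minpoly ℚ_[p] x).toSubring _ hc, (Polynomial.monic_toSubring _ _ hc).2 hmon, ?_⟩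
    rw [← hmap, ← Polynomial.eval₂_map, Polynomial.map_toSubring]
    exact minpoly.aeval _ _

end Padic

section FiniteGeneration
open scoped IsMulCommutative

/-- An irreducible representation of a commutative group that is generated, modulo the stabilizer of
a nonzero vector, by finitely many elements is finite-dimensional. -/
theorem finiteDimensional_of_comm {E C W : Type*} [Field E] [CommGroup C] [AddCommGroup W]
    [Module E W] (τ : Representation E C W)
    (hirr : ∀ N : Submodule E W, (∀ a, ∀ w ∈ N, τ a w ∈ N) → N = ⊥ ∨ N = ⊤)
    (v : W) (hv : v ≠ 0) (X : Set C) (hX : X.Finite)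
    (hgen : ∀ a, ∃ b ∈ Submonoid.closure X, τ a v = τ b v) : FiniteDimensional E W := by
  have hcomm : ∀ a b, τ a * τ b = τ b * τ a := fun a b => by rw [← map_mul, mul_comm, map_mul]
  let S : Subalgebra E (Module.End E W) := Algebra.adjoin E (τ '' X)
  have : IsMulCommutative S := Algebra.isMulCommutative_adjoin E (by
    rintro _ ⟨a, -, rfl⟩ _ ⟨b, -, rfl⟩
    exact hcomm a b)
  have hcent : ∀ s ∈ S, ∀ a, s * τ a = τ a * s := by
    intro s hs a
    have : S ≤ Subalgebra.centralizer E {τ a} := Algebra.adjoin_le (by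
      rintro _ ⟨b, -, rfl⟩
      rw [SetLike.mem_coe, Subalgebra.mem_centralizer_iff]
      rintro _ rfl
      exact hcomm a b)
    exact ((Subalgebra.mem_centralizer_iff E).1 (this hs) _ rfl).symm
  have hclos : ∀ b ∈ Submonoid.closure X, τ b ∈ S := by
    intro b hb
    induction hb using Submonoid.closure_induction with
    | mem b hb => exact Algebra.subset_adjoin ⟨b, hb, rfl⟩
    | one => rw [map_one]; exact one_mem S
    | mul a b _ _ ha hb => rw [map_mul]; exact mul_mem ha hb
  have hspan : ∀ w, w ≠ 0 → Submodule.span E (Set.range fun a => τ a w) = ⊤ := by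
    intro w hw
    refine (hirr _ fun a u hu => ?_).resolve_left fun h => hw ?_
    · induction hu using Submodule.span_induction with
      | mem u hu =>
        obtain ⟨b, rfl⟩ := hu
        refine Submodule.subset_span ⟨a * b, ?_⟩
        simp
      | zero => rw [map_zero]; exact zero_mem _
      | add u u' _ _ hu hu' => rw [map_add]; exact add_mem hu hu'
      | smul c u _ hu => rw [map_smul]; exact Submodule.smul_mem _ c hu
    · have : w ∈ Submodule.span E (Set.range fun a => τ a w) :=
        Submodule.subset_span ⟨1, by simp⟩
      rwa [h, Submodule.mem_bot] at this
  -- Since `s` commutes with the group, `hgen` passes from `v` to `s v`, so `S` already generates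
  -- `W` from `s v`.
  have hsurj : ∀ s ∈ S, s v ≠ 0 → ∀ w, ∃ s' ∈ S, s' (s v) = w := by
    intro s hs hsv w
    have hw : w ∈ Submodule.span E (Set.range fun a => τ a (s v)) := by
      rw [hspan _ hsv]; trivial
    induction hw using Submodule.span_induction with
    | mem w hw =>
      obtain ⟨a, rfl⟩ := hw
      obtain ⟨b, hb, hab⟩ := hgen a
      refine ⟨τ b, hclos b hb, ?_⟩
      have h : ∀ c, τ c (s v) = s (τ c v) := fun c =>
        (LinearMap.congr_fun (hcent s hs c) v).symm
      rw [h]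
      exact (congrArg s hab).symm.trans (h a).symm
    | zero => exact ⟨0, zero_mem S, rfl⟩
    | add w w' _ _ h h' =>
      obtain ⟨t, ht, rfl⟩ := h
      obtain ⟨t', ht', rfl⟩ := h'
      exact ⟨t + t', add_mem ht ht', rfl⟩
    | smul c w _ h =>
      obtain ⟨t, ht, rfl⟩ := h
      exact ⟨c • t, S.smul_mem ht c, rfl⟩
  have hinj : ∀ s ∈ S, s v = 0 → s = 0 := by
    intro s hs hsv
    ext w
    have hw : w ∈ Submodule.span E (Set.range fun a => τ a v) := by
      rw [hspan v hv]; trivial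
    induction hw using Submodule.span_induction with
    | mem w hw =>
      obtain ⟨a, rfl⟩ := hw
      have := LinearMap.congr_fun (hcent s hs a) v
      rw [Module.End.mul_apply, Module.End.mul_apply, hsv, map_zero] at this
      exact this
    | zero => rw [map_zero, map_zero]
    | add w w' _ _ h h' => rw [map_add, map_add, h, h']
    | smul c w _ h => rw [map_smul, map_smul, h]
  have hnt : Nontrivial S := ⟨⟨0, 1, fun h => hv (by
    have := LinearMap.congr_fun (congrArg Subtype.val h) v
    exact this.symm)⟩⟩
  have hfield : IsField S :=
    { exists_pair_ne := hnt.exists_pair_ne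
      mul_comm := mul_comm
      mul_inv_cancel := fun {s} hs => by
        have hsv : (s : Module.End E W) v ≠ 0 := fun h => hs (Subtype.ext (hinj s s.2 h))
        obtain ⟨s', hs', h⟩ := hsurj s s.2 hsv v
        refine ⟨⟨s', hs'⟩, ?_⟩
        rw [mul_comm]
        refine Subtype.ext (sub_eq_zero.1 (hinj _ (sub_mem (mul_mem hs' s.2) (one_mem S)) ?_))
        exact sub_eq_zero.2 h }
  let : Field S := hfield.toField
  have hft : Algebra.FiniteType E S :=
    S.fg_iff_finiteType.1 (Subalgebra.fg_def.2 ⟨_, hX.image τ, rfl⟩)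
  -- Zariski's lemma: a field of finite type over `E` is finite over `E`. Evaluation at `v` then
  -- carries finiteness to `W`.
  have hfin : Module.Finite E S := finite_of_finite_type_of_isJacobsonRing E S
  refine Module.Finite.of_surjective
    ((LinearMap.applyₗ v : Module.End E W →ₗ[E] W).comp S.val.toLinearMap) fun w => ?_
  obtain ⟨s', hs', h⟩ := hsurj 1 (one_mem S) hv w
  exact ⟨⟨s', hs'⟩, h⟩

end FiniteGeneration
end IwasawaGL2
-- The unipotent group, its scalings and its power filtration.
namespace IwasawaGL2

section Unipotent
open Matrix

/-- The unipotent matrix `(1 x; 0 1)`. -/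
def upper {F : Type*} [Field F] (x : F) : GL (Fin 2) F where
  val := !![1, x; 0, 1]
  inv := !![1, -x; 0, 1]
  val_inv := by simp [Matrix.one_fin_two]
  inv_val := by simp [Matrix.one_fin_two]

theorem coe_upper {F : Type*} [Field F] (x : F) :
    (upper x : Matrix (Fin 2) (Fin 2) F) = !![1, x; 0, 1] := rfl

theorem upper_add {F : Type*} [Field F] (x y : F) : upper (x + y) = upper x * upper y := by
  refine Units.ext ?_
  rw [Units.val_mul, coe_upper, coe_upper, coe_upper]
  simp [add_comm]

theorem upper_zero {F : Type*} [Field F] : upper (0 : F) = 1 :=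
  Units.ext (by rw [coe_upper, Units.val_one, Matrix.one_fin_two])

theorem continuous_upper {F : Type*} [NormedField F] : Continuous (upper : F → GL (Fin 2) F) := by
  rw [Units.continuous_iff]
  constructor
  · refine continuous_matrix fun i j => ?_
    fin_cases i <;> fin_cases j <;> simp [upper] <;> fun_prop
  · refine continuous_matrix fun i j => ?_
    fin_cases i <;> fin_cases j <;> simp [upper] <;> fun_prop

variable {p : ℕ} [Fact p.Prime] {F : Type*} [NormedField F] [NormedAlgebra ℚ_[p] F]

/-- The element of `U` with a given upper right entry. -/
def unip (x : F) (hx : x ∈ ringOfIntegers p F) : unipotent p F := ⟨upper x, x, hx, rfl⟩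

/-- The upper right entry of an element of `U`. -/
def entry (h : unipotent p F) : F := (h.1 : Matrix (Fin 2) (Fin 2) F) 0 1

theorem entry_unip (x : F) (hx : x ∈ ringOfIntegers p F) : entry (unip x hx) = x := rfl

theorem upper_entry (h : unipotent p F) : upper (entry h) = h.1 := by
  obtain ⟨x, hx, hg⟩ := h.2
  refine Units.ext ?_
  rw [coe_upper, entry, hg]
  rfl

theorem entry_mem (h : unipotent p F) : entry h ∈ ringOfIntegers p F := by
  obtain ⟨x, hx, hg⟩ := h.2
  rw [entry, hg]
  exact hx

theorem entry_injective : Function.Injective (entry : unipotent p F → F) := fun g h hgh =>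
  Subtype.ext (by rw [← upper_entry, hgh, upper_entry])

theorem entry_mul (g h : unipotent p F) : entry (g * h) = entry g + entry h := by
  have : (g * h).1 = upper (entry g + entry h) := by
    rw [upper_add, upper_entry, upper_entry]; rfl
  rw [entry, this]
  rfl

theorem entry_one : entry (1 : unipotent p F) = 0 := by
  have := entry_mul (1 : unipotent p F) 1
  rwa [mul_one, left_eq_add] at this

theorem entry_pow (g : unipotent p F) (n : ℕ) : entry (g ^ n) = n * entry g := by
  induction n with
  | zero => rw [pow_zero, entry_one, Nat.cast_zero, zero_mul]
  | succ n ih => rw [pow_succ, entry_mul, ih, Nat.cast_succ, add_mul, one_mul]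

theorem continuous_entry : Continuous (entry : unipotent p F → F) :=
  (Units.continuous_val.comp continuous_subtype_val).matrix_elem 0 1

/-- The endomorphism of `U` induced by the multiplication with an integer `a` of `F`. -/
def scale (a : F) (ha : a ∈ ringOfIntegers p F) : unipotent p F →* unipotent p F where
  toFun h := unip (a * entry h) (mul_mem ha (entry_mem h))
  map_one' := entry_injective (by rw [entry_unip, entry_one, mul_zero])
  map_mul' g h := entry_injective (by simp only [entry_mul, entry_unip, mul_add])

theorem entry_scale (a : F) (ha : a ∈ ringOfIntegers p F) (h : unipotent p F) :
    entry (scale a ha h) = a * entry h := rfl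

theorem continuous_scale (a : F) (ha : a ∈ ringOfIntegers p F) : Continuous (scale a ha) :=
  (continuous_upper.comp (continuous_const.mul continuous_entry)).subtype_mk _

/-- The endomorphisms of `U` induced by multiplications with integers of `F`. -/
def scalings (p : ℕ) [Fact p.Prime] (F : Type*) [NormedField F] [NormedAlgebra ℚ_[p] F] :
    Submonoid (unipotent p F →* unipotent p F) where
  carrier := {θ | ∃ (a : F) (ha : a ∈ ringOfIntegers p F), θ = scale a ha}
  -- Multiplication in this monoid is pointwise, corresponding to addition of scalars; its unit is
  -- the scaling by `0`, not the identity map.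
  one_mem' := ⟨0, zero_mem _, MonoidHom.ext fun h => entry_injective (by
    rw [MonoidHom.one_apply, entry_one, entry_scale, zero_mul])⟩
  mul_mem' := by
    rintro _ _ ⟨a, ha, rfl⟩ ⟨b, hb, rfl⟩
    exact ⟨a + b, add_mem ha hb, MonoidHom.ext fun h => entry_injective (by
      rw [MonoidHom.mul_apply, entry_mul, entry_scale, entry_scale, entry_scale, add_mul])⟩

theorem continuous_of_mem_scalings (θ : unipotent p F →* unipotent p F) (hθ : θ ∈ scalings p F) :
    Continuous θ := by
  obtain ⟨a, ha, rfl⟩ := hθ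
  exact continuous_scale a ha

variable [FiniteDimensional ℚ_[p] F]

theorem exists_pow_eq_iff (n : ℕ) (h : unipotent p F) :
    (∃ t, t ^ p ^ n = h) ↔ ‖entry h‖ ≤ (p : ℝ)⁻¹ ^ n := by
  have hn : ‖((p ^ n : ℕ) : F)‖ = (p : ℝ)⁻¹ ^ n := by rw [Nat.cast_pow, norm_pow, norm_prime]
  have hpos : 0 < (p : ℝ)⁻¹ ^ n :=
    pow_pos (inv_pos.2 (Nat.cast_pos.2 (Nat.Prime.pos Fact.out))) n
  have h0 : ((p ^ n : ℕ) : F) ≠ 0 := norm_ne_zero_iff.1 (hn.trans_ne hpos.ne')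
  constructor
  · rintro ⟨t, rfl⟩
    rw [entry_pow, norm_mul, hn]
    exact mul_le_of_le_one_right hpos.le (mem_ringOfIntegers_iff.1 (entry_mem t))
  · intro hh
    have hx : ((p ^ n : ℕ) : F)⁻¹ * entry h ∈ ringOfIntegers p F := by
      rw [mem_ringOfIntegers_iff, norm_mul, norm_inv, hn]
      exact (inv_mul_le_one₀ hpos).2 hh
    refine ⟨unip _ hx, entry_injective ?_⟩
    rw [entry_pow, entry_unip, mul_inv_cancel_left₀ h0]

theorem exists_finset_reps_unipotent :
    ∃ R : Finset (unipotent p F), ∀ t, ∃ e ∈ R, ∃ s, t = e * s ^ p := by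
  classical
  have : ProperSpace F := FiniteDimensional.proper ℚ_[p] F
  have hpos : 0 < (p : ℝ)⁻¹ := inv_pos.2 (Nat.cast_pos.2 (Nat.Prime.pos Fact.out))
  obtain ⟨t, ht, hfin, hcov⟩ := (isCompact_closedBall (0 : F) 1).finite_cover_balls hpos
  have hmem : ∀ x : t, x.1 ∈ ringOfIntegers p F := fun x =>
    mem_ringOfIntegers_iff.2 (mem_closedBall_zero_iff.1 (ht x.2))
  have : Fintype t := hfin.fintype
  refine ⟨Finset.univ.image fun x : t => unip x.1 (hmem x), fun h => ?_⟩
  obtain ⟨x, hx, hxh⟩ := Set.mem_iUnion₂.1 (hcov (mem_closedBall_zero_iff.2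
    (mem_ringOfIntegers_iff.1 (entry_mem h))))
  refine ⟨_, Finset.mem_image_of_mem _ (Finset.mem_univ ⟨x, hx⟩), ?_⟩
  obtain ⟨s, hs⟩ := (exists_pow_eq_iff 1 ((unip x (hmem ⟨x, hx⟩))⁻¹ * h)).2 (by
    have h1 := entry_mul (unip x (hmem ⟨x, hx⟩)) ((unip x (hmem ⟨x, hx⟩))⁻¹ * h)
    rw [mul_inv_cancel_left, entry_unip] at h1
    rw [pow_one, eq_sub_iff_add_eq'.2 h1.symm, ← dist_eq_norm]
    exact (Metric.mem_ball.1 hxh).le)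
  refine ⟨s, ?_⟩
  rw [pow_one] at hs
  rw [hs, mul_inv_cancel_left]

/-- The filtration of `U` by the subgroups of `p ^ n`-th powers. -/
noncomputable def unipotentFiltration (p : ℕ) [Fact p.Prime] (F : Type*) [NormedField F]
    [NormedAlgebra ℚ_[p] F] [FiniteDimensional ℚ_[p] F] : PowerFiltration p (unipotent p F) where
  level n := ⟨(powMonoidHom (p ^ n)).range, by
    refine Subgroup.isOpen_of_mem_nhds _ (g := 1) ?_
    have hpos : 0 < (p : ℝ)⁻¹ ^ n :=
      pow_pos (inv_pos.2 (Nat.cast_pos.2 (Nat.Prime.pos Fact.out))) n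
    have h1 : entry ⁻¹' Metric.ball (0 : F) ((p : ℝ)⁻¹ ^ n) ∈ nhds (1 : unipotent p F) :=
      continuous_entry.continuousAt.preimage_mem_nhds (by
        rw [entry_one]
        exact Metric.ball_mem_nhds _ hpos)
    refine Filter.mem_of_superset h1 fun h hh => ?_
    exact (exists_pow_eq_iff n h).2 (mem_ball_zero_iff.1 hh).le⟩
  mem_level n h := Iff.rfl
  exists_level_le V := by
    have h1 : {x : F | ∀ hx : x ∈ ringOfIntegers p F, unip x hx ∈ V} ∈ nhds (0 : F) := by
      obtain ⟨O, hO, hOV⟩ := isOpen_induced_iff.1 V.isOpen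
      have h2 : upper ⁻¹' O ∈ nhds (0 : F) := (hO.preimage continuous_upper).mem_nhds (by
        have : (1 : unipotent p F) ∈ Subtype.val ⁻¹' O := by rw [hOV]; exact V.one_mem
        rw [Set.mem_preimage, upper_zero]
        exact this)
      refine Filter.mem_of_superset h2 fun x hx hx' => ?_
      have : unip x hx' ∈ Subtype.val ⁻¹' O := hx
      rwa [hOV] at this
    obtain ⟨ε, hε, hball⟩ := Metric.mem_nhds_iff.1 h1
    obtain ⟨n, hn⟩ := exists_pow_lt_of_lt_one hε
      (inv_lt_one_of_one_lt₀ (Nat.one_lt_cast.2 (Nat.Prime.one_lt (Fact.out : p.Prime))))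
    refine ⟨n, fun h hh => ?_⟩
    have h3 := hball (mem_ball_zero_iff.2 (((exists_pow_eq_iff n h).1 hh).trans_lt hn))
      (entry_mem h)
    convert h3
    exact entry_injective rfl
  reps := exists_finset_reps_unipotent.choose
  exists_rep := exists_finset_reps_unipotent.choose_spec

/-- The quotient of the entries of `e ^ p ^ n` and `s` is integral, since the former has norm at
most `p⁻ⁿ` and the latter a larger one. -/
theorem exists_scaling (e s : unipotent p F) (n : ℕ) (hs : s ∉ (unipotentFiltration p F).level n) :
    ∃ θ ∈ scalings p F, θ s = e ^ p ^ n := by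
  rw [PowerFiltration.mem_level, exists_pow_eq_iff, not_le] at hs
  have hpos : 0 < (p : ℝ)⁻¹ ^ n :=
    pow_pos (inv_pos.2 (Nat.cast_pos.2 (Nat.Prime.pos Fact.out))) n
  have h0 : entry s ≠ 0 := norm_ne_zero_iff.1 (hpos.trans hs).ne'
  have ha : ((p ^ n : ℕ) : F) * entry e / entry s ∈ ringOfIntegers p F := by
    rw [mem_ringOfIntegers_iff, norm_div, ← entry_pow]
    exact div_le_one_of_le₀ (((exists_pow_eq_iff n _).1 ⟨e, rfl⟩).trans hs.le) (norm_nonneg _)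
  refine ⟨scale _ ha, ⟨_, ha, rfl⟩, entry_injective ?_⟩
  rw [entry_scale, entry_pow, div_mul_cancel₀ _ h0]

end Unipotent
end IwasawaGL2
-- Twisting the action of the Iwasawa algebra.
namespace IwasawaGL2
open IwasawaAlgebra

section Twist

variable {E H W : Type*} [Field E] [CommGroup H] [TopologicalSpace H] [AddCommGroup W] [Module E W]

theorem act_of {ρ : Representation E H W} (hρ : IsSmooth ρ) (h : H) (v : W) :
    act hρ (of h) v = ρ h v := by
  refine (finiteAct_single ρ (stab hρ v) h 1 v _).trans (one_smul _ _)

theorem finiteAct_mapLevel (ρ : Representation E H W) (θ : H →* H) (hθ : Continuous θ)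
    (t t' : Module.End E W) (ht : ∀ h w, t (ρ h (t' w)) = ρ (θ h) w) (V : OpenSubgroup H) (x : MonoidAlgebra E (H ⧸ (V.comap θ hθ : Subgroup H))) (v : W)
    (hv : ∀ g ∈ V, ρ g v = v) (hv' : ∀ g ∈ V.comap θ hθ, ρ g (t' v) = t' v) :
    finiteAct ρ V (mapLevel E θ hθ V x) v hv = t (finiteAct ρ (V.comap θ hθ) x (t' v) hv') := by
  induction x using MonoidAlgebra.induction_linear with
  | zero =>
    unfold finiteAct
    simp only [map_zero, LinearMap.zero_apply, Submodule.coe_zero]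
  | add x y hx hy =>
    unfold finiteAct at hx hy ⊢
    simp only [map_add, LinearMap.add_apply, Submodule.coe_add, hx, hy]
  | single g c =>
    obtain ⟨g, rfl⟩ := QuotientGroup.mk_surjective g
    rw [mapLevel_single, finiteAct_single, finiteAct_single, map_smul, ht]

/-- If `t` conjugates the action of `H` on `W` to its twist by `θ`, then it also conjugates the
action of `E[[H]]` to its twist by the endomorphism of `E[[H]]` induced by `θ`. -/
theorem act_map {ρ : Representation E H W} (hρ : IsSmooth ρ) (θ : H →* H) (hθ : Continuous θ)
    (t t' : Module.End E W) (htt : ∀ w, t' (t w) = w)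
    (ht : ∀ h w, t (ρ h (t' w)) = ρ (θ h) w) (x : IwasawaAlgebra E H) (v : W) :
    act hρ (IwasawaAlgebra.map θ hθ x) v = t (act hρ x (t' v)) := by
  have hv : ∀ g ∈ stab hρ v, ρ g v = v := fun g hg => hg
  have hv' : ∀ g ∈ (stab hρ v).comap θ hθ, ρ g (t' v) = t' v := fun g hg => by
    rw [← htt (ρ g (t' v)), ht, hv _ hg]
  rw [act_eq hρ _ v _ hv, act_eq hρ x (t' v) _ hv']
  exact finiteAct_mapLevel ρ θ hθ t t' ht _ _ v hv hv'

theorem mapLevel_eq_algebraMap (θ : H →* H) (hθ : Continuous θ) (V : OpenSubgroup H)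
    (hV : ∀ h, θ h ∈ V) (x : MonoidAlgebra E (H ⧸ (V.comap θ hθ : Subgroup H))) :
    mapLevel E θ hθ V x = algebraMap E _ (coeffSum E _ x) := by
  induction x using MonoidAlgebra.induction_linear with
  | zero => simp only [map_zero]
  | add x y hx hy => simp only [map_add, hx, hy]
  | single g c =>
    obtain ⟨g, rfl⟩ := QuotientGroup.mk_surjective g
    rw [mapLevel_single, coeffSum_single, (QuotientGroup.eq_one_iff _).2 (hV g)]
    rfl

theorem proj_map_eq_algebraMap (θ : H →* H) (hθ : Continuous θ) (V : OpenSubgroup H)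
    (hV : ∀ h, θ h ∈ V) (x : IwasawaAlgebra E H) :
    proj V (IwasawaAlgebra.map θ hθ x) = algebraMap E _ (aug x) := by
  rw [proj_map, mapLevel_eq_algebraMap θ hθ V hV, coeffSum_proj]

/-- Group elements moved into the stabilizer of `v` act trivially on it, leaving the sum of
coefficients. This serves both to show that an annihilator has augmentation zero and to treat the
scaling by `0`. -/
theorem act_map_of_mem_stab {ρ : Representation E H W} (hρ : IsSmooth ρ) (θ : H →* H)
    (hθ : Continuous θ) (v : W) (hV : ∀ h, θ h ∈ stab hρ v) (x : IwasawaAlgebra E H) :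
    act hρ (IwasawaAlgebra.map θ hθ x) v = aug x • v := by
  have h1 : act hρ (IwasawaAlgebra.map θ hθ x) v = act hρ (algebraMap E _ (aug x)) v := by
    unfold act
    congr 1
    exact (proj_map_eq_algebraMap θ hθ _ hV x)
  rw [h1]
  change iwasawaAction hρ _ v = _
  rw [AlgHom.commutes]
  rfl

end Twist

/-! ### Normal subgroups of `GL₂(F)`. -/

section GL2
open Matrix

/-- The diagonal matrix `(a 0; 0 1)`, as a homomorphism. -/
noncomputable def diagHom (F : Type*) [Field F] : Fˣ →* GL (Fin 2) F :=
  Units.map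
    { toFun := fun a => !![a, 0; 0, 1]
      map_one' := Matrix.one_fin_two.symm
      map_mul' := fun a b => by simp }

theorem coe_diagHom {F : Type*} [Field F] (a : Fˣ) :
    (diagHom F a : Matrix (Fin 2) (Fin 2) F) = !![(a : F), 0; 0, 1] := rfl

theorem det_diagHom {F : Type*} [Field F] (a : Fˣ) : (diagHom F a).det = a :=
  Units.ext (by
    rw [Matrix.GeneralLinearGroup.val_det_apply, coe_diagHom, Matrix.det_fin_two]
    simp)

theorem continuous_diagHom {F : Type*} [NormedField F] : Continuous (diagHom F) := by
  refine Continuous.units_map _ (continuous_matrix fun i j => ?_)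
  fin_cases i <;> fin_cases j <;> simp <;> fun_prop

theorem diagHom_mul_upper {F : Type*} [Field F] (a : Fˣ) (x : F) :
    diagHom F a * upper x * (diagHom F a)⁻¹ = upper (a * x) := by
  rw [mul_inv_eq_iff_eq_mul]
  refine Units.ext ?_
  rw [Units.val_mul, Units.val_mul, coe_upper, coe_upper, coe_diagHom]
  simp

/-- A normal subgroup of `GL₂(F)` that contains a nontrivial unipotent matrix contains `SL₂(F)`. -/
theorem mem_of_det_eq_one {F : Type*} [Field F] (N : Subgroup (GL (Fin 2) F)) [N.Normal] (c : F)
    (hc : c ≠ 0) (hN : upper c ∈ N) (g : GL (Fin 2) F) (hg : g.det = 1) : g ∈ N := by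
  have hU : ∀ x : F, upper x ∈ N := fun x => by
    rcases eq_or_ne x 0 with rfl | hx
    · rw [upper_zero]
      exact one_mem N
    · have := ‹N.Normal›.conj_mem _ hN (diagHom F (Units.mk0 (x / c) (div_ne_zero hx hc)))
      rwa [diagHom_mul_upper, Units.val_mk0, div_mul_cancel₀ _ hc] at this
  let w : GL (Fin 2) F := ⟨!![0, 1; 1, 0], !![0, 1; 1, 0], by simp [Matrix.one_fin_two],
    by simp [Matrix.one_fin_two]⟩
  have hw : (w : Matrix (Fin 2) (Fin 2) F) = !![0, 1; 1, 0] := rfl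
  have hw' : ((w⁻¹ : GL (Fin 2) F) : Matrix (Fin 2) (Fin 2) F) = !![0, 1; 1, 0] := rfl
  have hL : ∀ x : F, ∃ l ∈ N, (l : Matrix (Fin 2) (Fin 2) F) = !![1, 0; x, 1] := fun x =>
    ⟨_, ‹N.Normal›.conj_mem _ (hU x) w, by
      rw [Units.val_mul, Units.val_mul, hw, hw', coe_upper]
      simp⟩
  have key : ∀ g : GL (Fin 2) F, g.det = 1 → (g : Matrix (Fin 2) (Fin 2) F) 1 0 ≠ 0 → g ∈ N := by
    intro g hg h0
    have hdet : (g : Matrix (Fin 2) (Fin 2) F).det = 1 := by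
      rw [← Matrix.GeneralLinearGroup.val_det_apply, hg, Units.val_one]
    rw [Matrix.det_fin_two] at hdet
    obtain ⟨l, hl, hl'⟩ := hL ((g : Matrix (Fin 2) (Fin 2) F) 1 0)
    -- The outer factors are forced by the diagonal entries; the upper right entry then agrees
    -- because the determinant is one.
    have : g = upper (((g : Matrix (Fin 2) (Fin 2) F) 0 0 - 1) / (g : Matrix (Fin 2) (Fin 2) F) 1 0) *
        l * upper (((g : Matrix (Fin 2) (Fin 2) F) 1 1 - 1) / (g : Matrix (Fin 2) (Fin 2) F) 1 0) := by
      refine Units.ext ?_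
      rw [Units.val_mul, Units.val_mul, coe_upper, coe_upper, hl',
        Matrix.eta_fin_two (g : Matrix (Fin 2) (Fin 2) F)]
      simp only [Matrix.cons_mul, Matrix.of_apply, Matrix.cons_val]
      ext i j
      fin_cases i <;> fin_cases j <;> simp <;> field_simp <;>
        first | ring1 | linear_combination -hdet
    rw [this]
    exact mul_mem (mul_mem (hU _) hl) (hU _)
  by_cases h0 : (g : Matrix (Fin 2) (Fin 2) F) 1 0 = 0
  · obtain ⟨l, hl, hl'⟩ := hL 1
    have hdl : l.det = 1 := Units.ext (by
      rw [Matrix.GeneralLinearGroup.val_det_apply, hl', Matrix.det_fin_two]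
      simp)
    have : l * g ∈ N := key _ (by rw [map_mul, hdl, hg, one_mul]) (by
      rw [Units.val_mul, hl', Matrix.mul_apply, Fin.sum_univ_two, h0]
      have hdet : (g : Matrix (Fin 2) (Fin 2) F).det = 1 := by
        rw [← Matrix.GeneralLinearGroup.val_det_apply, hg, Units.val_one]
      rw [Matrix.det_fin_two, h0, mul_zero, sub_zero] at hdet
      simpa using left_ne_zero_of_mul_eq_one hdet)
    exact (N.mul_mem_cancel_left hl).1 this
  · exact key g hg h0

end GL2
end IwasawaGL2
-- Finite-dimensionality, and stability of the annihilator under scalings.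
namespace IwasawaGL2
open IwasawaAlgebra

/-- A subspace stable under an irreducible representation is trivial. -/
theorem eq_bot_or_eq_top_of_isIrreducible {E G W : Type*} [Field E] [Group G]
    [AddCommGroup W] [Module E W] {ρ : Representation E G W}
    (hirr : ρ.IsIrreducible) (N : Submodule E W) (hN : ∀ g, ∀ w ∈ N, ρ g w ∈ N) :
    N = ⊥ ∨ N = ⊤ := by
  let N' : Subrepresentation ρ := ⟨N, fun g w hw => hN g w hw⟩
  rcases hirr.eq_bot_or_eq_top N' with h | h
  · exact Or.inl (congrArg Subrepresentation.toSubmodule h)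
  · exact Or.inr (congrArg Subrepresentation.toSubmodule h)

/-- The multiplicative group of `F` is finitely generated modulo any neighbourhood of `1`. -/
theorem exists_finite_generators (p : ℕ) [Fact p.Prime] {F : Type*} [NormedField F]
    [NormedAlgebra ℚ_[p] F] [FiniteDimensional ℚ_[p] F] (S : Set Fˣ) (hS : S ∈ nhds (1 : Fˣ)) :
    ∃ X : Set Fˣ, X.Finite ∧ ∀ a, ∃ b ∈ Submonoid.closure X, b⁻¹ * a ∈ S := by
  classical
  have : ProperSpace F := FiniteDimensional.proper ℚ_[p] F
  have hp1 : (1 : ℝ) < p := Nat.one_lt_cast.2 (Nat.Prime.one_lt Fact.out)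
  have hp0 : (0 : ℝ) < p := zero_lt_one.trans hp1
  obtain ⟨ε, hε, hball⟩ : ∃ ε > 0, ∀ a : Fˣ, ‖(a : F) - 1‖ < ε → a ∈ S := by
    rw [Units.isOpenEmbedding_val.isInducing.nhds_eq_comap, Units.val_one] at hS
    obtain ⟨O, hO, hOS⟩ := hS
    obtain ⟨ε, hε, h⟩ := Metric.mem_nhds_iff.1 hO
    exact ⟨ε, hε, fun a ha => hOS (h (mem_ball_iff_norm.2 ha))⟩
  have hcomp : IsCompact (Metric.closedBall (0 : F) 1 \ Metric.ball 0 (p : ℝ)⁻¹) :=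
    (isCompact_closedBall 0 1).diff Metric.isOpen_ball
  -- Powers of `p` move any unit into this annulus. Its points `c` have norm at least `p⁻¹`, so
  -- distance less than `ε / p` from `c` becomes distance less than `ε` from `1` after division by
  -- `c`.
  obtain ⟨t, ht, hfin, hcov⟩ := hcomp.finite_cover_balls (mul_pos hε (inv_pos.2 hp0))
  let P : Fˣ := Units.mk0 (p : F) (prime_ne_zero p F)
  refine ⟨{P, P⁻¹} ∪ Units.val ⁻¹' t,
    (Set.toFinite _).union (hfin.preimage Units.val_injective.injOn), fun a => ?_⟩
  set X : Set Fˣ := {P, P⁻¹} ∪ Units.val ⁻¹' t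
  have hP : P ∈ Submonoid.closure X := Submonoid.subset_closure (Or.inl (Or.inl rfl))
  have hP' : P⁻¹ ∈ Submonoid.closure X := Submonoid.subset_closure (Or.inl (Or.inr rfl))
  have hPz : ∀ n : ℤ, P ^ n ∈ Submonoid.closure X := fun n => by
    obtain ⟨k, rfl | rfl⟩ := n.eq_nat_or_neg
    · rw [zpow_natCast]; exact pow_mem hP k
    · rw [zpow_neg, zpow_natCast, ← inv_pow]; exact pow_mem hP' k
  obtain ⟨n, hn1, hn2⟩ := exists_mem_Ico_zpow (norm_pos_iff.2 a.ne_zero) hp1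
  have hnorm : ‖((a * P ^ (n + 1) : Fˣ) : F)‖ = ‖(a : F)‖ / (p : ℝ) ^ (n + 1) := by
    rw [Units.val_mul, norm_mul, Units.val_zpow_eq_zpow_val, norm_zpow, Units.val_mk0, norm_prime,
      inv_zpow, div_eq_mul_inv]
  have hpn : (0 : ℝ) < (p : ℝ) ^ (n + 1) := zpow_pos hp0 _
  have hmem : ((a * P ^ (n + 1) : Fˣ) : F) ∈ Metric.closedBall (0 : F) 1 \ Metric.ball 0 (p : ℝ)⁻¹ := by
    refine ⟨?_, ?_⟩
    · rw [mem_closedBall_zero_iff, hnorm]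
      exact (div_le_one₀ hpn).2 hn2.le
    · rw [mem_ball_zero_iff, hnorm, not_lt, le_div_iff₀ hpn, zpow_add_one₀ hp0.ne', mul_comm,
        mul_assoc, mul_inv_cancel₀ hp0.ne', mul_one]
      exact hn1
  obtain ⟨c, hc, hac⟩ := Set.mem_iUnion₂.1 (hcov hmem)
  have hcn : (p : ℝ)⁻¹ ≤ ‖c‖ := by
    have := (ht hc).2
    rwa [mem_ball_zero_iff, not_lt] at this
  have hc0 : c ≠ 0 := norm_pos_iff.1 ((inv_pos.2 hp0).trans_le hcn)
  refine ⟨Units.mk0 c hc0 * P ^ (-(n + 1)), mul_mem (Submonoid.subset_closure (Or.inr hc))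
    (hPz _), hball _ ?_⟩
  have heq : ((Units.mk0 c hc0 * P ^ (-(n + 1)))⁻¹ * a : Fˣ) = (Units.mk0 c hc0)⁻¹ * (a * P ^ (n + 1)) := by
    rw [mul_inv, zpow_neg, inv_inv, mul_assoc, mul_comm a]
  rw [heq, Units.val_mul, Units.val_inv_eq_inv_val, Units.val_mk0,
    show c⁻¹ * ((a * P ^ (n + 1) : Fˣ) : F) - 1 = c⁻¹ * (((a * P ^ (n + 1) : Fˣ) : F) - c) by
      rw [mul_sub, inv_mul_cancel₀ hc0], norm_mul, norm_inv]
  rw [mem_ball_iff_norm] at hac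
  rw [inv_mul_lt_iff₀ (norm_pos_iff.2 hc0), mul_comm ‖c‖]
  exact hac.trans_le (mul_le_mul_of_nonneg_left hcn hε.le)

/-- A smooth irreducible representation of `GL₂(F)` on which a nontrivial unipotent matrix acts
trivially is finite-dimensional. -/
theorem finiteDimensional_of_upper_trivial (p : ℕ) [Fact p.Prime] {F : Type*} [NormedField F]
    [NormedAlgebra ℚ_[p] F] [FiniteDimensional ℚ_[p] F] {E W : Type*} [Field E] [AddCommGroup W]
    [Module E W] {π : Representation E (GL (Fin 2) F) W} (hsmooth : IsSmooth π) (hirr : π.IsIrreducible) (c : F)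
    (hc : c ≠ 0) (htriv : π (upper c) = 1) : FiniteDimensional E W := by
  have hdet : ∀ g, π g = π (diagHom F g.det) := fun g => by
    have h1 : (diagHom F g.det)⁻¹ * g ∈ MonoidHom.ker π := mem_of_det_eq_one _ c hc htriv _ (by
      rw [map_mul, map_inv, det_diagHom, inv_mul_cancel])
    rw [← mul_inv_cancel_left (diagHom F g.det) g, map_mul, MonoidHom.mem_ker.1 h1, mul_one,
      mul_inv_cancel_left]
  have hnt : Nontrivial W := by
    by_contra h
    rw [not_nontrivial_iff_subsingleton] at h
    have := hirr.toNontrivial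
    exact bot_ne_top (α := Subrepresentation π) (SetLike.ext fun w => by
      rw [Subsingleton.elim w 0]
      exact ⟨fun _ => zero_mem (⊤ : Subrepresentation π).toSubmodule,
        fun _ => zero_mem (⊥ : Subrepresentation π).toSubmodule⟩)
  obtain ⟨v, hv⟩ := exists_ne (0 : W)
  let τ : Representation E Fˣ W := π.comp (diagHom F)
  have hS : {a : Fˣ | τ a v = v} ∈ nhds (1 : Fˣ) :=
    ((hsmooth v).preimage continuous_diagHom).mem_nhds (by simp)
  obtain ⟨X, hX, hgen⟩ := exists_finite_generators p _ hS
  refine finiteDimensional_of_comm τ (fun N hN => eq_bot_or_eq_top_of_isIrreducible hirr N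
    fun g w hw => ?_) v hv X hX fun a => ?_
  · rw [hdet]
    exact hN g.det w hw
  · obtain ⟨b, hb, h⟩ := hgen a
    refine ⟨b, hb, ?_⟩
    have h' : τ (b⁻¹ * a) v = v := h
    conv_rhs => rw [← h']
    rw [← Module.End.mul_apply, ← map_mul, mul_inv_cancel_left]

/-- The annihilator of a nonzero smooth representation of `GL₂(F)` in `E[[U]]` is stable under the
endomorphisms induced by the multiplications with integers of `F`. -/
theorem iwasawaAction_map_eq_zero {p : ℕ} [Fact p.Prime] {F : Type*} [NormedField F]
    [NormedAlgebra ℚ_[p] F] [FiniteDimensional ℚ_[p] F] {E W : Type*} [Field E] [AddCommGroup W]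
    [Module E W] [Nontrivial W] {π : Representation E (GL (Fin 2) F) W} (hsmooth : IsSmooth π)
    (x : IwasawaAlgebra E (unipotent p F))
    (hx : iwasawaAction (hsmooth.restrict (unipotent p F)) x = 0)
    (θ : unipotent p F →* unipotent p F) (hθ : θ ∈ scalings p F) :
    iwasawaAction (hsmooth.restrict (unipotent p F))
      (IwasawaAlgebra.map θ (continuous_of_mem_scalings θ hθ) x) = 0 := by
  have hact : ∀ v, act (hsmooth.restrict (unipotent p F)) x v = 0 := fun v =>
    LinearMap.congr_fun hx v
  have hne : ∀ (a : F) (ha : a ∈ ringOfIntegers p F), a ≠ 0 → ∀ v,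
      act (hsmooth.restrict (unipotent p F))
        (IwasawaAlgebra.map (scale a ha) (continuous_scale a ha) x) v = 0 := by
    intro a ha ha0 v
    let d := diagHom F (Units.mk0 a ha0)
    rw [act_map (hsmooth.restrict (unipotent p F)) _ _ (π d) (π d⁻¹)
      (fun w => π.inv_self_apply d w), hact, map_zero]
    intro h w
    change (π d * π h.1 * π d⁻¹) w = π (scale a ha h).1 w
    rw [← map_mul, ← map_mul, ← upper_entry h, diagHom_mul_upper, ← upper_entry (scale a ha h),
      entry_scale, Units.val_mk0]
  obtain ⟨a, ha, rfl⟩ := hθ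
  refine LinearMap.ext fun v => ?_
  change act _ _ v = 0
  rcases eq_or_ne a 0 with rfl | ha0
  -- Scaling by `0` is not a conjugation. Scaling by a large power of `p` is, and it moves `U` into
  -- the stabilizer of `w`, where `x` acts by its augmentation.
  · have haug : aug x = 0 := by
      obtain ⟨w, hw⟩ := exists_ne (0 : W)
      obtain ⟨n, hn⟩ := (unipotentFiltration p F).exists_level_le
        (stab (hsmooth.restrict (unipotent p F)) w)
      have hpn : ((p ^ n : ℕ) : F) ∈ ringOfIntegers p F := natCast_mem _ _
      have h0 : ((p ^ n : ℕ) : F) ≠ 0 := by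
        rw [Nat.cast_pow]
        exact pow_ne_zero n (prime_ne_zero p F)
      have h1 := hne _ hpn h0 w
      rw [act_map_of_mem_stab _ _ _ _ fun h => hn ?_] at h1
      · exact (smul_eq_zero.1 h1).resolve_right hw
      · have : scale _ hpn h = h ^ p ^ n := entry_injective (by rw [entry_scale, entry_pow])
        rw [this]
        exact (unipotentFiltration p F).pow_mem_level n h
    rw [act_map_of_mem_stab _ _ _ _ fun h => ?_, haug, zero_smul]
    have : scale 0 ha h = 1 := entry_injective (by rw [entry_scale, entry_one, zero_mul])
    rw [this]
    exact one_mem _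
  · exact hne a ha ha0 v

end IwasawaGL2

theorem mainTheorem2 (p : ℕ) [Fact p.Prime]
    (F : Type*) [NormedField F] [NormedAlgebra ℚ_[p] F] [FiniteDimensional ℚ_[p] F]
    (E : Type*) [Field E] [CharP E p]
    (W : Type*) [AddCommGroup W] [Module E W]
    (π : Representation E (Matrix.GeneralLinearGroup (Fin 2) F) W)
    (hsmooth : IwasawaGL2.IsSmooth π)
    (hirr : π.IsIrreducible)
    (hdim : ¬ FiniteDimensional E W) :
    Function.Injective
      (IwasawaGL2.iwasawaAction (hsmooth.restrict (IwasawaGL2.unipotent p F))) := by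
  open IwasawaGL2 IwasawaAlgebra in
  have hnt : Nontrivial W := by
    by_contra h
    rw [not_nontrivial_iff_subsingleton] at h
    exact hdim inferInstance
  rw [injective_iff_map_eq_zero]
  intro x hx
  by_contra hx0
  let L := unipotentFiltration p F
  obtain ⟨n, hn⟩ := exists_pow_mem_of_map_mem L (scalings p F) continuous_of_mem_scalings
    exists_scaling (RingHom.ker (iwasawaAction (hsmooth.restrict (unipotent p F)))) x hx0
    fun θ hθ => iwasawaAction_map_eq_zero hsmooth x hx θ hθ
  -- Otherwise every element of `U` would be a `p`-th power, which fails for the entry `1`.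
  obtain ⟨e, he, he0⟩ : ∃ e ∈ L.reps, entry e ≠ 0 := by
    by_contra! h
    obtain ⟨e, he, s, hs⟩ := L.exists_rep (unip (1 : F) (one_mem _))
    have h1 : e = 1 := entry_injective (by rw [h e he, entry_one])
    have h2 := (exists_pow_eq_iff 1 (unip (1 : F) (one_mem _))).1 ⟨s, by
      rw [pow_one, hs, h1, one_mul]⟩
    rw [entry_unip, norm_one, pow_one] at h2
    exact h2.not_gt (inv_lt_one_of_one_lt₀
      (Nat.one_lt_cast.2 (Nat.Prime.one_lt (Fact.out : p.Prime))))
  have hmem : of (e ^ p ^ n) - 1 ∈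
      RingHom.ker (iwasawaAction (E := E) (hsmooth.restrict (unipotent p F))) := by
    rw [← of_sub_one_pow]
    -- The exponent is raised from `n` to `p ^ n`, so that Frobenius turns the power into a single
    -- group element minus one.
    exact Ideal.pow_mem_of_pow_mem _ (hn e he) (Nat.lt_pow_self (Nat.Prime.one_lt Fact.out)).le
  rw [RingHom.mem_ker, map_sub, map_one, sub_eq_zero] at hmem
  refine hdim (finiteDimensional_of_upper_trivial p hsmooth hirr (entry (e ^ p ^ n)) ?_ ?_)
  · rw [entry_pow, Nat.cast_pow]
    exact mul_ne_zero (pow_ne_zero n (prime_ne_zero p F)) he0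
  · rw [upper_entry, ← hmem]
    exact LinearMap.ext fun v => (act_of (hsmooth.restrict (unipotent p F)) (e ^ p ^ n) v).symm
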